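/- A dyadic subdivision of $[0,1]$ is a partition of $[0,1]$ into intervals obtained by repeatedly cutting intervals in half; dyadic subdivisions correspond to finite rooted ordered binary trees, the leaves of the tree being the intervals of the subdivision. Thompson's group $F$ is the group, under composition, of all homeomorphisms $f$ of $[0,1]$ for which there are two dyadic subdivisions, given by trees $T$ and $U$ with the same number of leaves, such that $f$ sends the $i$-th interval of the first linearly onto the $i$-th interval of the second, for every $i$; then $(T,U)$ is called a tree diagram for $f$. A tree diagram is reduced if there is no $i$ such that in both trees the $i$-th and $(i+1)$-st leaves are the two legs of a common caret; every element of $F$ has exactly one reduced tree diagram. A right vine is a tree which is a single leaf or whose root has a leaf as left child and a right vine as right child. An element of $F$ is positive if the bottom tree $U$ of its reduced tree diagram $(T,U)$ is a right vine. Let $x_0\in F$ send $[0,\frac14],[\frac14,\frac12],[\frac12,1]$ linearly onto $[0,\frac12],[\frac12,\frac34],[\frac34,1]$, and let $x_1\in F$ send $[0,\frac12],[\frac12,\frac58],[\frac58,\frac34],[\frac34,1]$ linearly onto $[0,\frac12],[\frac12,\frac34],[\frac34,\frac78],[\frac78,1]$. The length of an element of $F$ is the least length of a word in $x_0^{\pm1},x_1^{\pm1}$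 that represents it. **Theorem 5.2.1.** For $n\ge 0$ let $p_n$ denote the number of positive elements of $F$ of length $n$ (this number is finite), and let $p(x)=\sum_{n=0}^\infty p_n x^n$. Then $$p(x)=\frac{1-x^2}{1-2x-x^2+x^3}$$ as formal power series. In particular, $p_n$ satisfies the recurrence relation $$p_n=2p_{n-1}+p_{n-2}-p_{n-3}\qquad\text{for all } n\ge 3.$$ -/

import Mathlib

open PowerSeries

namespace ThompsonF

/-- A finite (rooted, ordered) binary tree: `BinaryTree.nil` is the trivial tree (a single leaf) and
`BinaryTree.node () l r` is a caret with the trees `l` and `r` attached to its two legs. -/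
abbrev BTree : Type := BinaryTree Unit

/-- The tree with a single leaf. -/
abbrev leaf : BTree := BinaryTree.nil

/-- A caret with left subtree `l` and right subtree `r`. -/
abbrev caret (l r : BTree) : BTree := BinaryTree.node () l r

/-- The subdivision of the interval `[a, b]` encoded by a binary tree: a leaf stands for the
undivided interval, a caret for cutting the interval in half and then subdividing the two halves.
The intervals are listed from left to right, each as the pair of its endpoints. -/
noncomputable def subdivision : BTree → ℝ → ℝ → List (ℝ × ℝ)
  | BinaryTree.nil, a, b => [(a, b)]
  | BinaryTree.node _ l r, a, b => subdivision l a ((a + b) / 2) ++ subdivision r ((a + b) / 2) b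

/-- `f` is linear (affine) on the interval `[I.1, I.2]` and takes it onto `[J.1, J.2]`,
preserving the orientation. -/
def MapsLinearly (f : unitInterval ≃ₜ unitInterval) (I J : ℝ × ℝ) : Prop :=
  ∀ t : unitInterval, I.1 ≤ (t : ℝ) → (t : ℝ) ≤ I.2 →
    (f t : ℝ) = J.1 + (J.2 - J.1) / (I.2 - I.1) * ((t : ℝ) - I.1)

/-- `(T, U)` is a tree diagram for the homeomorphism `f` of `[0, 1]`: the dyadic subdivisions
of `[0, 1]` encoded by `T` (domain, top tree) and `U` (range, bottom tree) have the same number of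
intervals, and `f` sends each interval of the first linearly onto the corresponding interval of
the second. -/
def IsTreeDiagram (f : unitInterval ≃ₜ unitInterval) (T U : BTree) : Prop :=
  List.Forall₂ (MapsLinearly f) (subdivision T 0 1) (subdivision U 0 1)

/-- A dyadic rearrangement of `[0, 1]`. -/
def IsDyadicRearrangement (f : unitInterval ≃ₜ unitInterval) : Prop :=
  ∃ T U : BTree, IsTreeDiagram f T U

/-! ### Dyadic rearrangements form a group -/

theorem subdivision_bounds (T : BTree) : ∀ {a b : ℝ}, a < b → ∀ I ∈ subdivision T a b,
    a ≤ I.1 ∧ I.1 < I.2 ∧ I.2 ≤ b := by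
  induction T with
  | nil =>
    intro a b hab I hI
    simp only [subdivision, List.mem_singleton] at hI
    subst hI
    exact ⟨le_rfl, hab, le_rfl⟩
  | node _ l r ihl ihr =>
    intro a b hab I hI
    simp only [subdivision, List.mem_append] at hI
    rcases hI with hI | hI
    · obtain ⟨h1, h2, h3⟩ := ihl (by linarith) I hI
      exact ⟨h1, h2, by linarith⟩
    · obtain ⟨h1, h2, h3⟩ := ihr (by linarith) I hI
      exact ⟨by linarith, h2, h3⟩

theorem length_subdivision (T : BTree) : ∀ a b : ℝ,
    (subdivision T a b).length = T.numLeaves := by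
  induction T with
  | nil => intro a b; simp [subdivision, BinaryTree.numLeaves]
  | node _ l r ihl ihr => intro a b; simp [subdivision, BinaryTree.numLeaves, ihl, ihr]

theorem mapsLinearly_symm {f : unitInterval ≃ₜ unitInterval} {I J : ℝ × ℝ}
    (hI : 0 ≤ I.1 ∧ I.1 < I.2 ∧ I.2 ≤ 1) (hJ : J.1 < J.2)
    (h : MapsLinearly f I J) : MapsLinearly f⁻¹ J I := by
  intro t h1 h2
  have hd : 0 < J.2 - J.1 := by linarith
  have he : 0 < I.2 - I.1 := by linarith [hI.2.1]
  have hq0 : 0 ≤ (t - J.1) / (J.2 - J.1) := div_nonneg (by linarith) hd.le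
  have hq1 : (t - J.1) / (J.2 - J.1) ≤ 1 := by rw [div_le_one hd]; linarith
  obtain ⟨q, hq⟩ : ∃ q : ℝ, q = (t - J.1) / (J.2 - J.1) := ⟨_, rfl⟩
  rw [← hq] at hq0 hq1
  have htq : (t : ℝ) = J.1 + (J.2 - J.1) * q := by
    rw [hq]
    field_simp
    ring
  have hs1 : I.1 ≤ I.1 + (I.2 - I.1) * q := by nlinarith
  have hs2 : I.1 + (I.2 - I.1) * q ≤ I.2 := by nlinarith
  have hs := h ⟨I.1 + (I.2 - I.1) * q, by linarith [hI.1], by linarith [hI.2.2]⟩ hs1 hs2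
  have hft : f ⟨I.1 + (I.2 - I.1) * q, by linarith [hI.1], by linarith [hI.2.2]⟩ = t := by
    apply Subtype.ext
    rw [hs, htq]
    field_simp
    ring
  have : f⁻¹ t = ⟨I.1 + (I.2 - I.1) * q, by linarith [hI.1], by linarith [hI.2.2]⟩ := by
    rw [← hft]
    exact f.symm_apply_apply _
  rw [this]
  change I.1 + (I.2 - I.1) * q = _
  rw [hq]
  ring

theorem mapsLinearly_comp {f g : unitInterval ≃ₜ unitInterval} {I J K : ℝ × ℝ}
    (hI : I.1 < I.2) (hJ : J.1 < J.2)
    (hg : MapsLinearly g I J) (hf : MapsLinearly f J K) : MapsLinearly (f * g) I K := by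
  intro t h1 h2
  have he : 0 < I.2 - I.1 := by linarith
  have hd : 0 < J.2 - J.1 := by linarith
  have e1 := hg t h1 h2
  have hq0 : 0 ≤ (t - I.1) / (I.2 - I.1) := div_nonneg (by linarith) he.le
  have hq1 : (t - I.1) / (I.2 - I.1) ≤ 1 := by rw [div_le_one he]; linarith
  have e2 : (g t : ℝ) = J.1 + (J.2 - J.1) * ((t - I.1) / (I.2 - I.1)) := by
    rw [e1]; ring
  have e3 := hf (g t) (by rw [e2]; nlinarith) (by rw [e2]; nlinarith)
  change ((f (g t) : unitInterval) : ℝ) = _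
  rw [e3, e1]
  field_simp
  ring

/-- Replace each interval of a list by a subdivision of it. -/
noncomputable def refine (L : List (ℝ × ℝ)) (s : List BTree) : List (ℝ × ℝ) :=
  (List.zipWith (fun I S => subdivision S I.1 I.2) L s).flatten

theorem refine_append {L L' : List (ℝ × ℝ)} {s s' : List BTree} (h : L.length = s.length) :
    refine (L ++ L') (s ++ s') = refine L s ++ refine L' s' := by
  simp [refine, List.zipWith_append h]

theorem exists_graft (T : BTree) : ∀ s : List BTree, s.length = T.numLeaves →
    ∃ T' : BTree, ∀ a b : ℝ, subdivision T' a b = refine (subdivision T a b) s := by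
  induction T with
  | nil =>
    intro s hs
    simp only [BinaryTree.numLeaves] at hs
    obtain ⟨S, rfl⟩ := List.length_eq_one_iff.mp hs
    exact ⟨S, fun a b => by simp [refine, subdivision]⟩
  | node _ l r ihl ihr =>
    intro s hs
    simp only [BinaryTree.numLeaves] at hs
    obtain ⟨l', hl⟩ := ihl (s.take l.numLeaves) (by simp; omega)
    obtain ⟨r', hr⟩ := ihr (s.drop l.numLeaves) (by simp; omega)
    refine ⟨caret l' r', fun a b => ?_⟩
    simp only [subdivision]
    conv_rhs => rw [← List.take_append_drop l.numLeaves s]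
    rw [refine_append (by rw [length_subdivision]; simp; omega), hl, hr]

theorem exists_common_refinement (T : BTree) : ∀ U : BTree, ∃ s s' : List BTree,
    s.length = T.numLeaves ∧ s'.length = U.numLeaves ∧
      ∀ a b : ℝ, refine (subdivision T a b) s = refine (subdivision U a b) s' := by
  have key : ∀ U : BTree, ∃ s' : List BTree, s'.length = U.numLeaves ∧
      ∀ a b : ℝ, refine (subdivision U a b) s' = subdivision U a b := by
    intro U
    induction U with
    | nil => exact ⟨[leaf], by simp [BinaryTree.numLeaves], by simp [refine, subdivision]⟩
    | node _ l r ihl ihr =>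
      obtain ⟨s, hs, h⟩ := ihl
      obtain ⟨s', hs', h'⟩ := ihr
      refine ⟨s ++ s', by simp [BinaryTree.numLeaves, hs, hs'], fun a b => ?_⟩
      simp only [subdivision]
      rw [refine_append (by rw [length_subdivision, hs]), h, h']
  induction T with
  | nil =>
    intro U
    obtain ⟨s', hs', h⟩ := key U
    exact ⟨[U], s', by simp [BinaryTree.numLeaves], hs', fun a b => by
      rw [h]; simp [refine, subdivision]⟩
  | node x l r ihl ihr =>
    intro U
    cases U with
    | nil =>
      obtain ⟨s', hs', h⟩ := key (caret l r)
      exact ⟨s', [caret l r], hs', by simp [BinaryTree.numLeaves], fun a b => by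
        rw [h]; simp [refine, subdivision]⟩
    | node y l' r' =>
      obtain ⟨s, s', hs, hs', h⟩ := ihl l'
      obtain ⟨t, t', ht, ht', k⟩ := ihr r'
      refine ⟨s ++ t, s' ++ t', by simp [BinaryTree.numLeaves, hs, ht],
        by simp [BinaryTree.numLeaves, hs', ht'], fun a b => ?_⟩
      simp only [subdivision]
      rw [refine_append (by rw [length_subdivision, hs]),
        refine_append (by rw [length_subdivision, hs']), h, k]

theorem mapsLinearly_subdivision {f : unitInterval ≃ₜ unitInterval} (S : BTree) :
    ∀ {a b c d : ℝ}, a < b → MapsLinearly f (a, b) (c, d) →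
      List.Forall₂ (MapsLinearly f) (subdivision S a b) (subdivision S c d) := by
  induction S with
  | nil => intro a b c d _ h; simpa [subdivision] using h
  | node _ l r ihl ihr =>
    intro a b c d hab h
    have hne : b - a ≠ 0 := by linarith
    have hne1 : (a + b) / 2 - a ≠ 0 := by linarith
    have hne2 : b - (a + b) / 2 ≠ 0 := by linarith
    have e1 : ((c + d) / 2 - c) / ((a + b) / 2 - a) = (d - c) / (b - a) := by
      rw [div_eq_div_iff hne1 hne]; ring
    have e2 : (d - (c + d) / 2) / (b - (a + b) / 2) = (d - c) / (b - a) := by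
      rw [div_eq_div_iff hne2 hne]; ring
    simp only [subdivision]
    refine List.rel_append (ihl (by linarith) ?_) (ihr (by linarith) ?_)
    · intro t h1 h2
      simp only at h1 h2 ⊢
      rw [h t h1 (by simp only; linarith)]
      simp only
      rw [e1]
    · intro t h1 h2
      simp only at h1 h2 ⊢
      rw [h t (by simp only; linarith) h2]
      simp only
      rw [e2]
      field_simp
      ring

theorem forall₂_refine {f : unitInterval ≃ₜ unitInterval} {L M : List (ℝ × ℝ)}
    (h : List.Forall₂ (MapsLinearly f) L M) : ∀ (s : List BTree), (∀ I ∈ L, I.1 < I.2) →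
      List.Forall₂ (MapsLinearly f) (refine L s) (refine M s) := by
  induction h with
  | nil => intro s _; simp [refine]
  | @cons I J L M hIJ _ ih =>
    intro s hL
    cases s with
    | nil => simp [refine]
    | cons S s =>
      have := List.rel_append
        (mapsLinearly_subdivision S (hL I (by simp)) (show MapsLinearly f (I.1, I.2) (J.1, J.2) from hIJ))
        (ih s (fun I hI => hL I (by simp [hI])))
      simpa [refine] using this

theorem isTreeDiagram_one : IsTreeDiagram 1 leaf leaf := by
  simp only [IsTreeDiagram, subdivision, List.forall₂_cons, List.Forall₂.nil, and_true]
  intro t _ _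
  simp

theorem IsTreeDiagram.inv {f : unitInterval ≃ₜ unitInterval} {T U : BTree}
    (h : IsTreeDiagram f T U) : IsTreeDiagram f⁻¹ U T := by
  have hT := subdivision_bounds T (zero_lt_one' ℝ)
  have hU := subdivision_bounds U (zero_lt_one' ℝ)
  unfold IsTreeDiagram at h ⊢
  generalize subdivision T 0 1 = L at *
  generalize subdivision U 0 1 = M at *
  induction h with
  | nil => exact List.Forall₂.nil
  | cons hIJ _ ih =>
    refine List.Forall₂.cons (mapsLinearly_symm (hT _ (by simp)) (hU _ (by simp)).2.1 hIJ) (ih ?_ ?_)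
    · exact fun I hI => hT I (by simp [hI])
    · exact fun I hI => hU I (by simp [hI])

/-- If `(T, U)` is a tree diagram for `g` and `(U, V)` is one for `f`, then `(T, V)` is one for
"`g` followed by `f`" (stated for lists of intervals). -/
theorem forall₂_comp {f g : unitInterval ≃ₜ unitInterval} {L M : List (ℝ × ℝ)}
    (hg : List.Forall₂ (MapsLinearly g) L M) : ∀ {N : List (ℝ × ℝ)},
    List.Forall₂ (MapsLinearly f) M N → (∀ I ∈ L, I.1 < I.2) → (∀ I ∈ M, I.1 < I.2) →
      List.Forall₂ (MapsLinearly (f * g)) L N := by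
  induction hg with
  | nil => intro N hf _ _; cases hf; exact List.Forall₂.nil
  | cons hIJ _ ih =>
    intro N hf hL hM
    cases hf with
    | cons hJK hf =>
      refine List.Forall₂.cons (mapsLinearly_comp (hL _ (by simp)) (hM _ (by simp)) hIJ hJK)
        (ih hf ?_ ?_)
      · exact fun I hI => hL I (by simp [hI])
      · exact fun I hI => hM I (by simp [hI])

theorem IsDyadicRearrangement.mul {f g : unitInterval ≃ₜ unitInterval}
    (hf : IsDyadicRearrangement f) (hg : IsDyadicRearrangement g) :
    IsDyadicRearrangement (f * g) := by
  obtain ⟨V, W, hf⟩ := hf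
  obtain ⟨T, U, hg⟩ := hg
  obtain ⟨s, s', hs, hs', e⟩ := exists_common_refinement U V
  have hTU : T.numLeaves = U.numLeaves := by
    rw [← length_subdivision T 0 1, ← length_subdivision U 0 1]; exact hg.length_eq
  have hVW : V.numLeaves = W.numLeaves := by
    rw [← length_subdivision V 0 1, ← length_subdivision W 0 1]; exact hf.length_eq
  obtain ⟨T', hT'⟩ := exists_graft T s (by omega)
  obtain ⟨U', hU'⟩ := exists_graft U s hs
  obtain ⟨W', hW'⟩ := exists_graft W s' (by omega)
  have bd : ∀ (S : BTree), ∀ I ∈ subdivision S 0 1, I.1 < I.2 := fun S I hI =>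
    (subdivision_bounds S (zero_lt_one' ℝ) I hI).2.1
  have h1 := forall₂_refine hg s (bd T)
  have h2 := forall₂_refine hf s' (bd V)
  rw [← e, ← hU', ← hW'] at h2
  rw [← hU', ← hT'] at h1
  exact ⟨T', W', forall₂_comp h1 h2 (bd T') (bd U')⟩

/-- Thompson's group `F`: the group of all dyadic rearrangements of `[0, 1]` under composition.
(The product `f * g` is the composite `f ∘ g`, as always for `unitInterval ≃ₜ unitInterval`.  The
opposite convention gives the opposite group on the same set; neither the notion of a positive
element nor the word length with respect to a given set depends on this choice.) -/
def F : Subgroup (unitInterval ≃ₜ unitInterval) where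
  carrier := {f | IsDyadicRearrangement f}
  mul_mem' := fun hf hg => hf.mul hg
  one_mem' := ⟨_, _, isTreeDiagram_one⟩
  inv_mem' := fun ⟨_, _, h⟩ => ⟨_, _, h.inv⟩

/-! ### The generators -/

/-- The homeomorphism sending `[0, 1/4], [1/4, 1/2], [1/2, 1]` linearly onto
`[0, 1/2], [1/2, 3/4], [3/4, 1]`. -/
noncomputable def x0Homeo : unitInterval ≃ₜ unitInterval where
  toFun t := ⟨min (2 * t) (min (t + 1 / 4) ((t + 1) / 2)), by
    have h0 := t.2.1
    have h1 := t.2.2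
    exact ⟨le_min (by linarith) (le_min (by linarith) (by linarith)),
      (min_le_right _ _).trans ((min_le_right _ _).trans (by linarith))⟩⟩
  invFun t := ⟨max (t / 2) (max (t - 1 / 4) (2 * t - 1)), by
    have h0 := t.2.1
    have h1 := t.2.2
    exact ⟨le_max_of_le_left (by linarith),
      max_le (by linarith) (max_le (by linarith) (by linarith))⟩⟩
  left_inv t := by
    apply Subtype.ext
    simp only [min_def, max_def]
    split_ifs <;> linarith
  right_inv t := by
    apply Subtype.ext
    simp only [min_def, max_def]
    split_ifs <;> linarith
  continuous_toFun := by fun_prop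
  continuous_invFun := by fun_prop

theorem x1_aux_left (t : ℝ) (h : t ≤ 1) :
    (fun u : ℝ => min u (max (u / 2 + 1 / 4) (max (u - 1 / 8) (2 * u - 1))))
      (max t (min (2 * t - 1 / 2) (min (t + 1 / 8) ((t + 1) / 2)))) = t := by
  have key : max t (min (2 * t - 1 / 2) (min (t + 1 / 8) ((t + 1) / 2))) =
      if t ≤ 1 / 2 then t else if t ≤ 5 / 8 then 2 * t - 1 / 2 else
        if t ≤ 3 / 4 then t + 1 / 8 else (t + 1) / 2 := by
    simp only [min_def, max_def]
    split_ifs <;> linarith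
  rw [key]
  split_ifs <;> simp only [min_def, max_def] <;> split_ifs <;> linarith

theorem x1_aux_right (t : ℝ) (h : t ≤ 1) :
    (fun u : ℝ => max u (min (2 * u - 1 / 2) (min (u + 1 / 8) ((u + 1) / 2))))
      (min t (max (t / 2 + 1 / 4) (max (t - 1 / 8) (2 * t - 1)))) = t := by
  have key : min t (max (t / 2 + 1 / 4) (max (t - 1 / 8) (2 * t - 1))) =
      if t ≤ 1 / 2 then t else if t ≤ 3 / 4 then t / 2 + 1 / 4 else
        if t ≤ 7 / 8 then t - 1 / 8 else 2 * t - 1 := by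
    simp only [min_def, max_def]
    split_ifs <;> linarith
  rw [key]
  split_ifs <;> simp only [min_def, max_def] <;> split_ifs <;> linarith

/-- The homeomorphism sending `[0, 1/2], [1/2, 5/8], [5/8, 3/4], [3/4, 1]` linearly onto
`[0, 1/2], [1/2, 3/4], [3/4, 7/8], [7/8, 1]`. -/
noncomputable def x1Homeo : unitInterval ≃ₜ unitInterval where
  toFun t := ⟨max t (min (2 * t - 1 / 2) (min (t + 1 / 8) ((t + 1) / 2))), by
    have h0 := t.2.1
    have h1 := t.2.2
    exact ⟨le_max_of_le_left h0,
      max_le h1 ((min_le_right _ _).trans ((min_le_right _ _).trans (by linarith)))⟩⟩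
  invFun t := ⟨min t (max (t / 2 + 1 / 4) (max (t - 1 / 8) (2 * t - 1))), by
    have h0 := t.2.1
    have h1 := t.2.2
    exact ⟨le_min h0 (le_max_of_le_left (by linarith)), min_le_of_left_le h1⟩⟩
  left_inv t := Subtype.ext (x1_aux_left t t.2.2)
  right_inv t := Subtype.ext (x1_aux_right t t.2.2)
  continuous_toFun := by fun_prop
  continuous_invFun := by fun_prop

theorem isTreeDiagram_x0 :
    IsTreeDiagram x0Homeo (caret (caret leaf leaf) leaf) (caret leaf (caret leaf leaf)) := by
  simp only [IsTreeDiagram, subdivision, List.cons_append, List.nil_append, List.forall₂_cons,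
    List.Forall₂.nil, and_true]
  refine ⟨?_, ?_, ?_⟩ <;> intro t h1 h2 <;> norm_num at h1 h2 ⊢ <;>
    change min (2 * (t : ℝ)) (min (t + 1 / 4) ((t + 1) / 2)) = _ <;>
    simp only [min_def] <;> split_ifs <;> linarith

theorem isTreeDiagram_x1 :
    IsTreeDiagram x1Homeo (caret leaf (caret (caret leaf leaf) leaf))
      (caret leaf (caret leaf (caret leaf leaf))) := by
  simp only [IsTreeDiagram, subdivision, List.cons_append, List.nil_append, List.forall₂_cons,
    List.Forall₂.nil, and_true]
  refine ⟨?_, ?_, ?_, ?_⟩ <;> intro t h1 h2 <;> norm_num at h1 h2 ⊢ <;>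
    change max (t : ℝ) (min (2 * (t : ℝ) - 1 / 2) (min (t + 1 / 8) ((t + 1) / 2))) = _ <;>
    simp only [min_def, max_def] <;> split_ifs <;> linarith

/-- The generator `x₀` of `F`. -/
noncomputable def x0 : F := ⟨x0Homeo, _, _, isTreeDiagram_x0⟩

/-- The generator `x₁` of `F`. -/
noncomputable def x1 : F := ⟨x1Homeo, _, _, isTreeDiagram_x1⟩

/-! ### Positive elements -/

/-- `HasExposedCaret T i`: the `i`-th and the `(i+1)`-st leaf of `T` (counted from `0`, from left to
right) are the two legs of one caret of `T`. -/
inductive HasExposedCaret : BTree → ℕ → Prop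
  | here : HasExposedCaret (caret leaf leaf) 0
  | left {l r : BTree} {i : ℕ} : HasExposedCaret l i → HasExposedCaret (caret l r) i
  | right {l r : BTree} {i : ℕ} : HasExposedCaret r i →
      HasExposedCaret (caret l r) (l.numLeaves + i)

/-- The pair `(T, U)` has no opposing pair of carets. -/
def IsReduced (T U : BTree) : Prop :=
  ∀ i : ℕ, ¬ (HasExposedCaret T i ∧ HasExposedCaret U i)

/-- A right vine: a long edge on the right with left edges emanating from it. -/
inductive IsRightVine : BTree → Prop
  | leaf : IsRightVine leaf
  | caret {T : BTree} : IsRightVine T → IsRightVine (caret leaf T)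

/-- An element of `F` is positive if the bottom tree of its reduced tree diagram is a right vine. -/
def IsPositive (f : F) : Prop :=
  ∃ T U : BTree, IsTreeDiagram (f : unitInterval ≃ₜ unitInterval) T U ∧ IsReduced T U ∧
    IsRightVine U

/-! ### Word length -/

/-- `g` has length `n` with respect to the subset `S` of the group `G`: `n` is the least length of
a word in the elements of `S` and their inverses that represents `g`. -/
def HasLength {G : Type*} [Group G] (S : Set G) (g : G) (n : ℕ) : Prop :=
  IsLeast {m : ℕ | ∃ w : List G, w.length = m ∧ (∀ s ∈ w, s ∈ S ∨ s⁻¹ ∈ S) ∧ w.prod = g} n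

/-- The set of positive elements of `F` of `{x₀, x₁}`-length `n`. -/
def positiveOfLength (n : ℕ) : Set F :=
  {f : F | IsPositive f ∧ HasLength {x0, x1} f n}

/-- The number `p n` of positive elements of `F` of `{x₀, x₁}`-length `n`. -/
noncomputable def p (n : ℕ) : ℕ := (positiveOfLength n).ncard

end ThompsonF

/-! A positive element is determined by the top tree `T` of its reduced diagram. A vine has its last
caret as its only exposed caret, so the trees that occur are those whose last two leaves do not form
a caret (`RightReduced`). Hence `p n` counts such trees by word length
(`exists_bijOn_positiveOfLength`), and the point is that this length is `totalWeight T`, a sum of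
local costs of the carets of `T`.

Upper bound (`reaches_totalWeight`): `f⁻¹` carries the vine to `T`. Left multiplication by `x0⁻¹`
rotates the image tree at the root, by `x1⁻¹` at the right child of the root. Growing `T` from the
vine caret by caret costs 1 on the left spine below the root; according to whether the right leg is
a leaf, it costs 1 or 3 in the interior and 0 or 2 on the right spine below the root. The root is
free.

Lower bound (`totalWeight_le_length`): follow the breakpoints `1 - 2^(-n)`, `n ≥ 2`, through the
letters of a word. For each letter there is a single pivot at which points enter or leave `{3/4,
7/8, …}`, so a letter is charged to at most one breakpoint (`exists_cost`). The parity of the charge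
of a breakpoint tells whether it ends in that set. Charge 0 keeps the map linear on the tail after
the breakpoint; charge 1 leaves the breakpoint on `{1/2, 1/4, …}` or sends the vine leaf after it to
the right half of a dyadic interval. So an interior caret with nontrivial right leg needs an odd
charge other than 1, and such a caret on the right spine needs a positive even charge: exactly the
costs above.

Counting: the generating functions of the three weights satisfy `W = 1 + XW + X^3 W(W-1)`, `L = 1 +
XLW` and `R = W(1 + (R-1)X^2)`, and the one sought is `LR`. The quadratic equation for `W` gives
`(1-XW)(1-X^2 W) = W(1-2X-X^2+X^3)`, so `W` cancels and a rational function remains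
(`genFun_totalWeight_mul`). -/

namespace ThompsonF

/-! ### Standard dyadic intervals -/

/-- The subinterval of `[a, b]` reached by repeated halving, where `false` selects the left half and
`true` the right half. -/
noncomputable def subcone : List Bool → ℝ → ℝ → ℝ × ℝ
  | [], a, b => (a, b)
  | false :: u, a, b => subcone u a ((a + b) / 2)
  | true :: u, a, b => subcone u ((a + b) / 2) b

/-- The standard dyadic interval with address `u`. -/
noncomputable def cone (u : List Bool) : ℝ × ℝ := subcone u 0 1

theorem subcone_append (u v : List Bool) : ∀ a b : ℝ,
    subcone (u ++ v) a b = subcone v (subcone u a b).1 (subcone u a b).2 := by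
  induction u with
  | nil => intro a b; rfl
  | cons x u ih => intro a b; cases x <;> simp [subcone, ih]

theorem subcone_bounds (u : List Bool) : ∀ {a b : ℝ}, a < b →
    a ≤ (subcone u a b).1 ∧ (subcone u a b).1 < (subcone u a b).2 ∧ (subcone u a b).2 ≤ b := by
  induction u with
  | nil => intro a b h; exact ⟨le_rfl, h, le_rfl⟩
  | cons x u ih =>
    intro a b h
    cases x
    · obtain ⟨h1, h2, h3⟩ := ih (show a < (a + b) / 2 by linarith)
      exact ⟨h1, h2, by simp only [subcone]; linarith⟩
    · obtain ⟨h1, h2, h3⟩ := ih (show (a + b) / 2 < b by linarith)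
      exact ⟨by simp only [subcone]; linarith, h2, h3⟩

theorem cone_bounds (u : List Bool) :
    0 ≤ (cone u).1 ∧ (cone u).1 < (cone u).2 ∧ (cone u).2 ≤ 1 :=
  subcone_bounds u zero_lt_one

theorem subcone_injective {a b : ℝ} (h : a < b) : ∀ u v : List Bool,
    subcone u a b = subcone v a b → u = v := by
  have strict : ∀ {a b : ℝ}, a < b → ∀ (x : Bool) (u : List Bool),
      subcone (x :: u) a b ≠ (a, b) := by
    intro a b h x u e
    cases x
    · have h3 := (subcone_bounds u (show a < (a + b) / 2 by linarith)).2.2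
      simp only [subcone] at e
      rw [e] at h3
      simp only at h3
      linarith
    · have h3 := (subcone_bounds u (show (a + b) / 2 < b by linarith)).1
      simp only [subcone] at e
      rw [e] at h3
      simp only at h3
      linarith
  intro u
  induction u generalizing a b with
  | nil =>
    intro v e
    cases v with
    | nil => rfl
    | cons x v => exact absurd e.symm (strict h x v)
  | cons x u ih =>
    intro v e
    cases v with
    | nil => exact absurd e (strict h x u)
    | cons y v =>
      cases x <;> cases y
      · rw [ih (show a < (a + b) / 2 by linarith) v e]
      · have h1 := subcone_bounds u (show a < (a + b) / 2 by linarith)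
        have h2 := subcone_bounds v (show (a + b) / 2 < b by linarith)
        simp only [subcone] at e
        rw [e] at h1
        linarith [h1.2.1, h1.2.2, h2.1]
      · have h1 := subcone_bounds v (show a < (a + b) / 2 by linarith)
        have h2 := subcone_bounds u (show (a + b) / 2 < b by linarith)
        simp only [subcone] at e
        rw [e] at h2
        linarith [h1.2.1, h1.2.2, h2.1]
      · rw [ih (show (a + b) / 2 < b by linarith) v e]

theorem cone_injective : Function.Injective cone := fun u v h =>
  subcone_injective zero_lt_one u v h

theorem subcone_append_true_fst_gt (u : List Bool) : ∀ {a b : ℝ}, a < b →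
    a < (subcone (u ++ [true]) a b).1 := by
  induction u with
  | nil => intro a b h; simp only [List.nil_append, subcone]; linarith
  | cons x u ih =>
    intro a b h
    cases x
    · exact ih (show a < (a + b) / 2 by linarith)
    · have := ih (show (a + b) / 2 < b by linarith)
      simp only [List.cons_append, subcone]
      linarith

/-- The endpoint is the midpoint of the interval with address `u`, and comparison with the midpoint
of `[a, b]` recovers `u` letter by letter. Addresses ending in `true` thus name interior dyadic
points uniquely. -/
theorem subcone_append_true_fst_injective (u : List Bool) : ∀ {a b : ℝ}, a < b → ∀ v : List Bool,
    (subcone (u ++ [true]) a b).1 = (subcone (v ++ [true]) a b).1 → u = v := by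
  have lower : ∀ (v : List Bool) {a b : ℝ}, a < b →
      (subcone (v ++ [true]) a ((a + b) / 2)).1 < (a + b) / 2 := fun v a b h => by
    have := subcone_bounds (v ++ [true]) (show a < (a + b) / 2 by linarith)
    linarith [this.2.1, this.2.2]
  have upper : ∀ (v : List Bool) {a b : ℝ}, a < b →
      (a + b) / 2 < (subcone (v ++ [true]) ((a + b) / 2) b).1 := fun v a b h =>
    subcone_append_true_fst_gt v (by linarith)
  induction u with
  | nil =>
    intro a b h v e
    rcases v with _ | ⟨_ | _, v⟩
    · rfl
    · exact absurd e.symm (lower v h).ne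
    · exact absurd e (upper v h).ne
  | cons x u ih =>
    intro a b h v e
    rcases v with _ | ⟨y, v⟩
    · cases x
      · exact absurd e (lower u h).ne
      · exact absurd e.symm (upper u h).ne
    · cases x <;> cases y
      · rw [ih (by linarith) v e]
      · exact absurd e ((lower u h).trans (upper v h)).ne
      · exact absurd e ((lower v h).trans (upper u h)).ne'
      · rw [ih (by linarith) v e]

theorem cone_replicate_true (n : ℕ) : cone (List.replicate n true) = (1 - (1 / 2) ^ n, 1) := by
  induction n with
  | zero => simp [cone, subcone]
  | succ n ih =>
    rw [List.replicate_succ', cone, subcone_append, ← cone, ih]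
    simp only [subcone, Prod.mk.injEq, and_true]
    ring

theorem cone_append_false_fst (u : List Bool) : (cone (u ++ [false])).1 = (cone u).1 := by
  rw [cone, subcone_append, ← cone]; rfl

theorem cone_append_replicate_false_fst (u : List Bool) (j : ℕ) :
    (cone (u ++ List.replicate j false)).1 = (cone u).1 := by
  induction j with
  | zero => simp
  | succ j ih => rw [List.replicate_succ', ← List.append_assoc, cone_append_false_fst, ih]

theorem cone_append_false (u : List Bool) :
    cone (u ++ [false]) = ((cone u).1, ((cone u).1 + (cone u).2) / 2) := by
  rw [cone, subcone_append, ← cone]; rfl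

theorem cone_append_true (u : List Bool) :
    cone (u ++ [true]) = (((cone u).1 + (cone u).2) / 2, (cone u).2) := by
  rw [cone, subcone_append, ← cone]; rfl

/-! ### Homeomorphisms acting linearly on standard dyadic intervals -/

/-- `f` takes the standard dyadic interval with address `u` linearly onto the one with
address `v`. -/
def MapsCone (f : unitInterval ≃ₜ unitInterval) (u v : List Bool) : Prop :=
  MapsLinearly f (cone u) (cone v)

theorem MapsCone.append {f : unitInterval ≃ₜ unitInterval} {u v : List Bool}
    (h : MapsCone f u v) (w : List Bool) : MapsCone f (u ++ w) (v ++ w) := by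
  have key : ∀ (w : List Bool) {a b c d : ℝ}, a < b → MapsLinearly f (a, b) (c, d) →
      MapsLinearly f (subcone w a b) (subcone w c d) := by
    intro w
    induction w with
    | nil => intro a b c d _ h; exact h
    | cons x w ih =>
      intro a b c d hab h
      have := mapsLinearly_subdivision (caret leaf leaf) hab h
      simp only [subdivision, List.cons_append, List.nil_append, List.forall₂_cons,
        List.Forall₂.nil, and_true] at this
      cases x
      · exact ih (by linarith) this.1
      · exact ih (by linarith) this.2
  unfold MapsCone cone
  rw [subcone_append, subcone_append]
  exact key w (cone_bounds u).2.1 h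

theorem MapsCone.comp {f g : unitInterval ≃ₜ unitInterval} {u v w : List Bool}
    (hg : MapsCone g u v) (hf : MapsCone f v w) : MapsCone (f * g) u w :=
  mapsLinearly_comp (cone_bounds u).2.1 (cone_bounds v).2.1 hg hf

theorem MapsCone.inv {f : unitInterval ≃ₜ unitInterval} {u v : List Bool}
    (h : MapsCone f u v) : MapsCone f⁻¹ v u :=
  mapsLinearly_symm (cone_bounds u) (cone_bounds v).2.1 h

theorem MapsCone.apply_fst {f : unitInterval ≃ₜ unitInterval} {u v : List Bool}
    (h : MapsCone f u v) {t : unitInterval} (ht : (t : ℝ) = (cone u).1) :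
    (f t : ℝ) = (cone v).1 := by
  have := h t ht.ge (by rw [ht]; exact (cone_bounds u).2.1.le)
  rw [this, ht]
  ring

theorem MapsCone.right_unique {f : unitInterval ≃ₜ unitInterval} {u v w : List Bool}
    (h : MapsCone f u v) (h' : MapsCone f u w) : v = w := by
  obtain ⟨h0, h1, h2⟩ := cone_bounds u
  have e1 : (cone v).1 = (cone w).1 := by
    rw [← h.apply_fst (t := ⟨(cone u).1, h0, by linarith⟩) rfl,
      ← h'.apply_fst (t := ⟨(cone u).1, h0, by linarith⟩) rfl]
  have k1 := h ⟨(cone u).2, by linarith, h2⟩ h1.le le_rfl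
  have k2 := h' ⟨(cone u).2, by linarith, h2⟩ h1.le le_rfl
  have hne : (cone u).2 - (cone u).1 ≠ 0 := by linarith
  rw [div_mul_cancel₀ _ hne] at k1 k2
  exact cone_injective (Prod.ext e1 (by linarith))

theorem MapsCone.eq_on {f g : unitInterval ≃ₜ unitInterval} {u v : List Bool}
    (hf : MapsCone f u v) (hg : MapsCone g u v) {t : unitInterval}
    (h1 : (cone u).1 ≤ t) (h2 : t ≤ (cone u).2) : f t = g t :=
  Subtype.ext ((hf t h1 h2).trans (hg t h1 h2).symm)

theorem mapsCone_one (u : List Bool) : MapsCone 1 u u := by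
  intro t _ _
  have hne : (cone u).2 - (cone u).1 ≠ 0 := by linarith [(cone_bounds u).2.1]
  rw [div_self hne]
  simp

theorem mapsCone_x0 (u : List Bool) :
    MapsCone x0 (false :: false :: u) (false :: u) ∧
    MapsCone x0 (false :: true :: u) (true :: false :: u) ∧
    MapsCone x0 (true :: u) (true :: true :: u) := by
  have h := isTreeDiagram_x0
  simp only [IsTreeDiagram, subdivision, List.cons_append, List.nil_append, List.forall₂_cons,
    List.Forall₂.nil, and_true] at h
  obtain ⟨h1, h2, h3⟩ := h
  exact ⟨MapsCone.append (u := [false, false]) (v := [false]) h1 u,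
    MapsCone.append (u := [false, true]) (v := [true, false]) h2 u,
    MapsCone.append (u := [true]) (v := [true, true]) h3 u⟩

theorem mapsCone_x0_inv (u : List Bool) :
    MapsCone (x0⁻¹ : F) (false :: u) (false :: false :: u) ∧
    MapsCone (x0⁻¹ : F) (true :: false :: u) (false :: true :: u) ∧
    MapsCone (x0⁻¹ : F) (true :: true :: u) (true :: u) :=
  ⟨(mapsCone_x0 u).1.inv, (mapsCone_x0 u).2.1.inv, (mapsCone_x0 u).2.2.inv⟩

theorem mapsCone_x1 (u : List Bool) :
    MapsCone x1 (false :: u) (false :: u) ∧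
    MapsCone x1 (true :: false :: false :: u) (true :: false :: u) ∧
    MapsCone x1 (true :: false :: true :: u) (true :: true :: false :: u) ∧
    MapsCone x1 (true :: true :: u) (true :: true :: true :: u) := by
  have h := isTreeDiagram_x1
  simp only [IsTreeDiagram, subdivision, List.cons_append, List.nil_append, List.forall₂_cons,
    List.Forall₂.nil, and_true] at h
  obtain ⟨h1, h2, h3, h4⟩ := h
  exact ⟨MapsCone.append (u := [false]) (v := [false]) h1 u,
    MapsCone.append (u := [true, false, false]) (v := [true, false]) h2 u,
    MapsCone.append (u := [true, false, true]) (v := [true, true, false]) h3 u,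
    MapsCone.append (u := [true, true]) (v := [true, true, true]) h4 u⟩

theorem mapsCone_x1_inv (u : List Bool) :
    MapsCone (x1⁻¹ : F) (false :: u) (false :: u) ∧
    MapsCone (x1⁻¹ : F) (true :: false :: u) (true :: false :: false :: u) ∧
    MapsCone (x1⁻¹ : F) (true :: true :: false :: u) (true :: false :: true :: u) ∧
    MapsCone (x1⁻¹ : F) (true :: true :: true :: u) (true :: true :: u) :=
  ⟨(mapsCone_x1 u).1.inv, (mapsCone_x1 u).2.1.inv, (mapsCone_x1 u).2.2.1.inv,
    (mapsCone_x1 u).2.2.2.inv⟩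

/-! ### Trees over the leaves of a right vine -/

/-- The address of the `n`-th leaf of a long right vine. -/
def vineLeaf (n : ℕ) : List Bool := List.replicate n true ++ [false]

/-- `g` takes the leaves of a right vine, from the `n`-th one on, linearly onto the leaves of the
tree `S` hanging at the address `u`. -/
def MapsInner (g : unitInterval ≃ₜ unitInterval) : BTree → List Bool → ℕ → Prop
  | BinaryTree.nil, u, n => MapsCone g (vineLeaf n) u
  | BinaryTree.node _ l r, u, n =>
      MapsInner g l (u ++ [false]) n ∧ MapsInner g r (u ++ [true]) (n + l.numLeaves)

/-- Like `MapsInner`, but the last leaf of `S` is the image of the last leaf of the right vine. -/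
def MapsOuter (g : unitInterval ≃ₜ unitInterval) : BTree → List Bool → ℕ → Prop
  | BinaryTree.nil, u, n => MapsCone g (List.replicate n true) u
  | BinaryTree.node _ l r, u, n =>
      MapsInner g l (u ++ [false]) n ∧ MapsOuter g r (u ++ [true]) (n + l.numLeaves)

/-- The right vine with `n` carets. -/
def vine : ℕ → BTree
  | 0 => leaf
  | n + 1 => caret leaf (vine n)

theorem isRightVine_vine (n : ℕ) : IsRightVine (vine n) := by
  induction n with
  | zero => exact .leaf
  | succ n ih => exact .caret ih

theorem IsRightVine.eq_vine {U : BTree} (h : IsRightVine U) : ∃ n, U = vine n := by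
  induction h with
  | leaf => exact ⟨0, rfl⟩
  | caret _ ih =>
    obtain ⟨n, rfl⟩ := ih
    exact ⟨n + 1, rfl⟩

theorem forall₂_append_iff {α β : Type*} {R : α → β → Prop} {l₁ l₂ : List α} {m₁ m₂ : List β}
    (h : l₁.length = m₁.length) :
    List.Forall₂ R (l₁ ++ l₂) (m₁ ++ m₂) ↔ List.Forall₂ R l₁ m₁ ∧ List.Forall₂ R l₂ m₂ := by
  induction l₁ generalizing m₁ with
  | nil =>
    cases m₁ with
    | nil => simp
    | cons => simp at h
  | cons a l₁ ih =>
    cases m₁ with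
    | nil => simp at h
    | cons b m₁ =>
      simp only [List.cons_append, List.forall₂_cons, ih (Nat.succ.inj h), and_assoc]

/-- The leaves number `n, …, n + k - 1` of a long right vine. -/
noncomputable def vineLeaves (n k : ℕ) : List (ℝ × ℝ) :=
  (List.range' n k).map fun i => cone (vineLeaf i)

theorem subdivision_vine (k : ℕ) : ∀ n : ℕ,
    subdivision (vine k) (cone (List.replicate n true)).1 (cone (List.replicate n true)).2 =
      vineLeaves n k ++ [cone (List.replicate (n + k) true)] := by
  induction k with
  | zero => intro n; simp [vine, subdivision, vineLeaves]
  | succ k ih =>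
    intro n
    have h := ih (n + 1)
    rw [List.replicate_succ', cone_append_true] at h
    simp only [vine, subdivision]
    rw [h, add_right_comm, add_assoc]
    simp [vineLeaves, List.range'_succ, vineLeaf, cone_append_false]

theorem mapsInner_iff (g : unitInterval ≃ₜ unitInterval) (S : BTree) : ∀ (u : List Bool) (n : ℕ),
    MapsInner g S u n ↔ List.Forall₂ (MapsLinearly g) (vineLeaves n S.numLeaves)
      (subdivision S (cone u).1 (cone u).2) := by
  induction S with
  | nil => intro u n; simp [MapsInner, vineLeaves, subdivision, MapsCone]
  | node _ l r ihl ihr =>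
    intro u n
    have e : vineLeaves n (l.numLeaves + r.numLeaves) =
        vineLeaves n l.numLeaves ++ vineLeaves (n + l.numLeaves) r.numLeaves := by
      simp [vineLeaves, ← List.map_append]
    simp only [MapsInner, subdivision, BinaryTree.numLeaves]
    rw [e, forall₂_append_iff (by simp [vineLeaves, length_subdivision]), ihl, ihr,
      cone_append_false, cone_append_true]

theorem mapsOuter_iff (g : unitInterval ≃ₜ unitInterval) (S : BTree) : ∀ (u : List Bool) (n : ℕ),
    MapsOuter g S u n ↔ List.Forall₂ (MapsLinearly g)
      (vineLeaves n S.numNodes ++ [cone (List.replicate (n + S.numNodes) true)])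
      (subdivision S (cone u).1 (cone u).2) := by
  induction S with
  | nil => intro u n; simp [MapsOuter, vineLeaves, subdivision, MapsCone]
  | node _ l r ihl ihr =>
    intro u n
    have e : vineLeaves n (l.numNodes + r.numNodes + 1) =
        vineLeaves n l.numLeaves ++ vineLeaves (n + l.numLeaves) r.numNodes := by
      simp only [vineLeaves, ← List.map_append, BinaryTree.numLeaves_eq_numNodes_succ]
      congr 2
      simp
      omega
    have e' : n + (l.numNodes + r.numNodes + 1) = n + l.numLeaves + r.numNodes := by
      rw [BinaryTree.numLeaves_eq_numNodes_succ]; omega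
    simp only [MapsOuter, subdivision, BinaryTree.numNodes]
    rw [e, e', List.append_assoc, forall₂_append_iff (by simp [vineLeaves, length_subdivision]),
      mapsInner_iff, ihr, cone_append_false, cone_append_true]

theorem isTreeDiagram_vine_iff (g : unitInterval ≃ₜ unitInterval) (T : BTree) (k : ℕ) :
    IsTreeDiagram g (vine k) T ↔ k = T.numNodes ∧ MapsOuter g T [] 0 := by
  have h := subdivision_vine k 0
  have h' := mapsOuter_iff g T [] 0
  simp only [List.replicate_zero, zero_add, cone, subcone] at h h'
  rw [h', IsTreeDiagram, h]
  constructor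
  · intro H
    have := H.length_eq
    simp only [vineLeaves, List.length_append, List.length_map, List.length_range',
      List.length_singleton, length_subdivision, BinaryTree.numLeaves_eq_numNodes_succ] at this
    obtain rfl : k = T.numNodes := by omega
    exact ⟨rfl, H⟩
  · rintro ⟨rfl, H⟩
    exact H

/-! ### Reduced trees -/

/-- The right spine of the tree does not end in a caret both of whose legs are leaves. -/
def RightReduced : BTree → Prop
  | BinaryTree.nil => True
  | BinaryTree.node _ l r => RightReduced r ∧ ¬ (l = leaf ∧ r = leaf)

theorem HasExposedCaret.add_two_le {T : BTree} {i : ℕ} (h : HasExposedCaret T i) :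
    i + 2 ≤ T.numLeaves := by
  induction h with
  | here => simp
  | left _ ih => simp; omega
  | right _ ih => simp; omega

theorem exists_hasExposedCaret_last {T : BTree} (h : ¬ RightReduced T) :
    ∃ i, i + 2 = T.numLeaves ∧ HasExposedCaret T i := by
  induction T with
  | nil => exact absurd trivial h
  | node _ l r _ ihr =>
    by_cases hlr : l = leaf ∧ r = leaf
    · obtain ⟨rfl, rfl⟩ := hlr
      exact ⟨0, rfl, .here⟩
    · obtain ⟨i, hi, h'⟩ := ihr fun hr => h ⟨hr, hlr⟩
      exact ⟨l.numLeaves + i, by simp; omega, .right h'⟩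

theorem not_hasExposedCaret_last {T : BTree} (h : RightReduced T) {i : ℕ}
    (hi : i + 2 = T.numLeaves) : ¬ HasExposedCaret T i := by
  have pos : ∀ S : BTree, 1 ≤ S.numLeaves := fun S => by
    rw [BinaryTree.numLeaves_eq_numNodes_succ]; omega
  intro hT
  induction hT with
  | here => exact h.2 ⟨rfl, rfl⟩
  | @left l r _ hl _ =>
    have := hl.add_two_le
    have := pos r
    simp at hi
    omega
  | right _ ih => exact ih h.1 (by simp at hi; omega)

theorem hasExposedCaret_vine {n i : ℕ} (h : HasExposedCaret (vine n) i) : i + 1 = n := by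
  induction n generalizing i with
  | zero => cases h
  | succ n ih =>
    generalize hT : vine (n + 1) = T at h
    cases h with
    | here =>
      cases n with
      | zero => rfl
      | succ n => simp [vine] at hT
    | left h =>
      simp only [vine, BinaryTree.node.injEq] at hT
      rw [← hT.2.1] at h
      cases h
    | @right l r i h =>
      simp only [vine, BinaryTree.node.injEq] at hT
      rw [← hT.2.2] at h
      rw [← hT.2.1, ← ih h]
      simp [add_comm]

theorem hasExposedCaret_vine_last (n : ℕ) : HasExposedCaret (vine (n + 1)) n := by
  induction n with
  | zero => exact .here
  | succ n ih =>
    have h := HasExposedCaret.right (l := leaf) ih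
    rw [show leaf.numLeaves + n = n + 1 from add_comm 1 n] at h
    exact h

/-- The vine exposes only its last caret, so only the end of the right spine of `T` can oppose it.
-/
theorem isReduced_vine_iff (T : BTree) : IsReduced T (vine T.numNodes) ↔ RightReduced T := by
  constructor
  · intro h
    by_contra hT
    obtain ⟨i, hi, h'⟩ := exists_hasExposedCaret_last hT
    rw [BinaryTree.numLeaves_eq_numNodes_succ] at hi
    refine h i ⟨h', ?_⟩
    rw [← show i + 1 = T.numNodes by omega]
    exact hasExposedCaret_vine_last i
  · rintro h i ⟨h1, h2⟩
    refine not_hasExposedCaret_last h ?_ h1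
    rw [BinaryTree.numLeaves_eq_numNodes_succ, ← hasExposedCaret_vine h2]

/-- Inverting puts the vine on the domain side. There all leaves but the last have addresses
independent of its size, so trees can be handled by recursion on `T` with a running leaf index. -/
theorem isPositive_iff (f : F) : IsPositive f ↔
    ∃ T, RightReduced T ∧ MapsOuter (f⁻¹ : F) T [] 0 := by
  constructor
  · rintro ⟨T, U, h, hr, hU⟩
    obtain ⟨k, rfl⟩ := hU.eq_vine
    obtain ⟨rfl, h'⟩ := (isTreeDiagram_vine_iff _ _ _).mp h.inv
    exact ⟨T, (isReduced_vine_iff T).mp hr, h'⟩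
  · rintro ⟨T, hT, h⟩
    refine ⟨T, vine T.numNodes, ?_, (isReduced_vine_iff T).mpr hT, isRightVine_vine _⟩
    have := ((isTreeDiagram_vine_iff _ _ _).mpr ⟨rfl, h⟩).inv
    simpa using this

/-! ### Uniqueness of the reduced tree -/

theorem MapsInner.first {g : unitInterval ≃ₜ unitInterval} {S : BTree} {u : List Bool} {n : ℕ}
    (h : MapsInner g S u n) :
    ∃ j, MapsCone g (vineLeaf n) (u ++ List.replicate j false) ∧ (j = 0 → S = leaf) := by
  induction S generalizing u n with
  | nil => exact ⟨0, by simpa [MapsInner] using h, fun _ => rfl⟩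
  | node _ l r ihl _ =>
    obtain ⟨j, hj, _⟩ := ihl h.1
    refine ⟨j + 1, ?_, fun h => absurd h (by omega)⟩
    rwa [List.append_assoc, List.singleton_append, ← List.replicate_succ] at hj

theorem MapsInner.eq_leaf {g : unitInterval ≃ₜ unitInterval} {S : BTree} {u : List Bool} {n : ℕ}
    (h : MapsInner g S u n) (h' : MapsCone g (vineLeaf n) u) : S = leaf := by
  obtain ⟨j, hj, hS⟩ := h.first
  have := congrArg List.length (h'.right_unique hj)
  exact hS (by simpa using this)

/-- Away from the last leaf no reducedness is needed: each vine leaf has only one image address, so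
a leaf of one tree cannot be a caret in the other. -/
theorem MapsInner.unique {g : unitInterval ≃ₜ unitInterval} {S S' : BTree} {u : List Bool} {n : ℕ}
    (h : MapsInner g S u n) (h' : MapsInner g S' u n) : S = S' := by
  induction S generalizing S' u n with
  | nil => exact (h'.eq_leaf h).symm
  | node _ l r ihl ihr =>
    cases S' with
    | nil => exact h.eq_leaf h'
    | node _ l' r' =>
      obtain rfl := ihl h.1 h'.1
      obtain rfl := ihr h.2 h'.2
      rfl

/-- If `g` is linear on the whole tail, every caret of `S` would cancel against one of the vine, and
reducedness forbids the last of these cancellations. -/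
theorem MapsOuter.eq_leaf {g : unitInterval ≃ₜ unitInterval} {S : BTree} {u : List Bool} {n : ℕ}
    (h : MapsOuter g S u n) (hS : RightReduced S) (h' : MapsCone g (List.replicate n true) u) :
    S = leaf := by
  induction S generalizing u n with
  | nil => rfl
  | node _ l r _ ihr =>
    have hl : l = leaf := h.1.eq_leaf (h'.append [false])
    subst hl
    have hr : r = leaf := ihr h.2 hS.1 (by
      have := h'.append [true]
      rwa [← List.replicate_succ'] at this)
    exact absurd ⟨rfl, hr⟩ hS.2

theorem MapsOuter.unique {g : unitInterval ≃ₜ unitInterval} {S S' : BTree} {u : List Bool} {n : ℕ}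
    (h : MapsOuter g S u n) (h' : MapsOuter g S' u n) (hS : RightReduced S)
    (hS' : RightReduced S') : S = S' := by
  induction S generalizing S' u n with
  | nil => exact (h'.eq_leaf hS' h).symm
  | node _ l r _ ihr =>
    cases S' with
    | nil => exact h.eq_leaf hS h'
    | node _ l' r' =>
      obtain rfl := h.1.unique h'.1
      obtain rfl := ihr h.2 h'.2 hS.1 hS'.1
      rfl

theorem cone_vineLeaf (n : ℕ) : cone (vineLeaf n) = (1 - (1 / 2) ^ n, 1 - (1 / 2) ^ (n + 1)) := by
  rw [vineLeaf, cone_append_false, cone_replicate_true]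
  simp only [Prod.mk.injEq, true_and]
  ring

theorem MapsInner.eq_on {g g' : unitInterval ≃ₜ unitInterval} {S : BTree} {u : List Bool} {n : ℕ}
    (h : MapsInner g S u n) (h' : MapsInner g' S u n) {t : unitInterval}
    (h1 : 1 - (1 / 2) ^ n ≤ (t : ℝ)) (h2 : (t : ℝ) ≤ 1 - (1 / 2) ^ (n + S.numLeaves)) :
    g t = g' t := by
  induction S generalizing u n with
  | nil =>
    refine MapsCone.eq_on h h' ?_ ?_ <;> rw [cone_vineLeaf]
    · exact h1
    · exact h2
  | node _ l r ihl ihr =>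
    rcases le_total (t : ℝ) (1 - (1 / 2) ^ (n + l.numLeaves)) with ht | ht
    · exact ihl h.1 h'.1 h1 ht
    · exact ihr h.2 h'.2 ht (by rwa [add_assoc])

theorem MapsOuter.eq_on {g g' : unitInterval ≃ₜ unitInterval} {S : BTree} {u : List Bool} {n : ℕ}
    (h : MapsOuter g S u n) (h' : MapsOuter g' S u n) {t : unitInterval}
    (h1 : 1 - (1 / 2) ^ n ≤ (t : ℝ)) : g t = g' t := by
  induction S generalizing u n with
  | nil =>
    refine MapsCone.eq_on h h' ?_ ?_ <;> rw [cone_replicate_true]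
    · exact h1
    · exact t.2.2
  | node _ l r ihl ihr =>
    rcases le_total (t : ℝ) (1 - (1 / 2) ^ (n + l.numLeaves)) with ht | ht
    · exact h.1.eq_on h'.1 h1 ht
    · exact ihr h.2 h'.2 ht

theorem MapsOuter.homeo_unique {g g' : unitInterval ≃ₜ unitInterval} {S : BTree} {u : List Bool}
    (h : MapsOuter g S u 0) (h' : MapsOuter g' S u 0) : g = g' :=
  Homeomorph.ext fun t => h.eq_on h' (by simpa using t.2.1)

/-! ### Weights of trees -/

/-- The cost of building a tree in the interior of the forest. -/
def weight : BTree → ℕ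
  | BinaryTree.nil => 0
  | BinaryTree.node _ l r => weight l + weight r + if r = leaf then 1 else 3

/-- The cost of building a left subtree of the root. -/
def leftWeight : BTree → ℕ
  | BinaryTree.nil => 0
  | BinaryTree.node _ l r => leftWeight l + weight r + 1

/-- The cost of building a right subtree of the root. -/
def rightWeight : BTree → ℕ
  | BinaryTree.nil => 0
  | BinaryTree.node _ l r => weight l + rightWeight r + if r = leaf then 0 else 2

/-- The length of the positive element with a given top tree. -/
def totalWeight : BTree → ℕ
  | BinaryTree.nil => 0
  | BinaryTree.node _ l r => leftWeight l + rightWeight r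

/-! ### Building trees by rotations -/

theorem MapsInner.comp {g s : unitInterval ≃ₜ unitInterval} {S : BTree} {u v : List Bool} {n : ℕ}
    (h : MapsInner g S u n) (hs : MapsCone s u v) : MapsInner (s * g) S v n := by
  induction S generalizing u v n with
  | nil => exact MapsCone.comp h hs
  | node _ l r ihl ihr => exact ⟨ihl h.1 (hs.append _), ihr h.2 (hs.append _)⟩

theorem MapsOuter.comp {g s : unitInterval ≃ₜ unitInterval} {S : BTree} {u v : List Bool} {n : ℕ}
    (h : MapsOuter g S u n) (hs : MapsCone s u v) : MapsOuter (s * g) S v n := by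
  induction S generalizing u v n with
  | nil => exact MapsCone.comp h hs
  | node _ l r _ ihr => exact ⟨h.1.comp (hs.append _), ihr h.2 (hs.append _)⟩

/-- A word of length `k` in the generators turns the tree `S` into the tree `T`. -/
def Reaches (k : ℕ) (S T : BTree) : Prop :=
  ∃ w : List F, w.length = k ∧ (∀ s ∈ w, s ∈ ({x0, x1} : Set F) ∨ s⁻¹ ∈ ({x0, x1} : Set F)) ∧
    ∀ g : F, MapsOuter g S [] 0 → MapsOuter (w.prod * g : F) T [] 0

theorem Reaches.refl (S : BTree) : Reaches 0 S S := ⟨[], rfl, by simp, fun g h => by simpa using h⟩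

theorem Reaches.trans {k k' : ℕ} {S T U : BTree} (h : Reaches k S T) (h' : Reaches k' T U) :
    Reaches (k + k') S U := by
  obtain ⟨w, rfl, hw, H⟩ := h
  obtain ⟨w', rfl, hw', H'⟩ := h'
  refine ⟨w' ++ w, by simp [add_comm], ?_, fun g hg => ?_⟩
  · intro s hs
    rcases List.mem_append.mp hs with hs | hs
    · exact hw' s hs
    · exact hw s hs
  · rw [List.prod_append, mul_assoc]
    exact H' _ (H g hg)

theorem Reaches.of_eq {k k' : ℕ} {S T : BTree} (h : Reaches k S T) (e : k = k') :
    Reaches k' S T := e ▸ h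

/-- `x0⁻¹` is linear on the intervals `0`, `10`, `11`, so the trees hanging there are moved intact.
-/
theorem reaches_x0_inv (A B C : BTree) :
    Reaches 1 (caret A (caret B C)) (caret (caret A B) C) := by
  refine ⟨[x0⁻¹], rfl, by simp, fun g ⟨hA, hB, hC⟩ => ?_⟩
  rw [List.prod_singleton]
  obtain ⟨h1, -, -⟩ := mapsCone_x0_inv []
  obtain ⟨-, h2, h3⟩ := mapsCone_x0_inv []
  refine ⟨⟨hA.comp h1, hB.comp h2⟩, ?_⟩
  rw [BinaryTree.numLeaves, ← add_assoc]
  exact hC.comp h3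

theorem reaches_x0 (A B C : BTree) :
    Reaches 1 (caret (caret A B) C) (caret A (caret B C)) := by
  refine ⟨[x0], rfl, by simp, fun g ⟨⟨hA, hB⟩, hC⟩ => ?_⟩
  rw [List.prod_singleton]
  obtain ⟨h1, h2, h3⟩ := mapsCone_x0 []
  rw [BinaryTree.numLeaves, ← add_assoc] at hC
  exact ⟨hA.comp h1, hB.comp h2, hC.comp h3⟩

theorem reaches_x1_inv (A B C D : BTree) :
    Reaches 1 (caret A (caret B (caret C D))) (caret A (caret (caret B C) D)) := by
  refine ⟨[x1⁻¹], rfl, by simp, fun g ⟨hA, hB, hC, hD⟩ => ?_⟩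
  rw [List.prod_singleton]
  obtain ⟨h1, h2, h3, h4⟩ := mapsCone_x1_inv []
  refine ⟨hA.comp h1, ⟨hB.comp h2, hC.comp h3⟩, ?_⟩
  rw [BinaryTree.numLeaves, ← add_assoc]
  exact hD.comp h4

/-- The tree obtained from `R` by adding `k` trivial trees at the start of its right spine. -/
def addLeaves : ℕ → BTree → BTree
  | 0, R => R
  | k + 1, R => caret leaf (addLeaves k R)

theorem addLeaves_add (k l : ℕ) (R : BTree) :
    addLeaves (k + l) R = addLeaves k (addLeaves l R) := by
  induction k with
  | zero => simp [addLeaves]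
  | succ k ih => rw [Nat.succ_add]; simp [addLeaves, ih]

theorem vine_add (k l : ℕ) : vine (k + l) = addLeaves k (vine l) := by
  induction k with
  | zero => simp [addLeaves]
  | succ k ih => rw [Nat.succ_add, vine, addLeaves, ih]

/-- New trees grow just to the right of the left leg `A`. Once `l` is built, a leaf `r` is already
adjacent and one rotation joins them. Otherwise `l` is first absorbed into the left leg by `x0⁻¹`,
`r` is grown in its place, `x0` releases `l`, and `x1⁻¹` joins: three letters. -/
theorem reaches_weight (S : BTree) : ∀ A R : BTree,
    Reaches (weight S) (caret A (addLeaves S.numLeaves R)) (caret A (caret S R)) := by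
  induction S with
  | nil => intro A R; exact .refl _
  | node _ l r ihl ihr =>
    intro A R
    simp only [BinaryTree.numLeaves, addLeaves_add, weight]
    have hl := ihl A (addLeaves r.numLeaves R)
    split_ifs with hr
    · subst hr
      exact (hl.trans (reaches_x1_inv A l leaf R)).of_eq (by simp [weight])
    · exact ((((hl.trans (reaches_x0_inv _ _ _)).trans (ihr _ _)).trans (reaches_x0 _ _ _)).trans
        (reaches_x1_inv A l r R)).of_eq (by omega)

/-- On the right spine no joining rotation is needed; only absorbing and releasing `l` costs, and
only if something remains to be built beyond it. -/
theorem reaches_rightWeight (R : BTree) : ∀ A : BTree,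
    Reaches (rightWeight R) (caret A (vine R.numNodes)) (caret A R) := by
  induction R with
  | nil => intro A; exact .refl _
  | node _ l r _ ihr =>
    intro A
    have e : (BinaryTree.node () l r).numNodes = l.numLeaves + r.numNodes := by
      rw [BinaryTree.numNodes, BinaryTree.numLeaves_eq_numNodes_succ]; omega
    rw [e, vine_add]
    have hl := reaches_weight l A (vine r.numNodes)
    simp only [rightWeight]
    split_ifs with hr
    · subst hr
      exact hl.of_eq (by simp [rightWeight])
    · exact (((hl.trans (reaches_x0_inv _ _ _)).trans (ihr _)).trans (reaches_x0 _ _ _)).of_eq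
        (by omega)

/-- Here `l` is itself the left leg of the root while `r` grows, so a single root rotation joins
them. -/
theorem reaches_leftWeight (S : BTree) : ∀ R : BTree,
    Reaches (leftWeight S) (addLeaves S.numLeaves R) (caret S R) := by
  induction S with
  | nil => intro R; exact .refl _
  | node _ l r ihl _ =>
    intro R
    simp only [BinaryTree.numLeaves, addLeaves_add, leftWeight]
    exact ((ihl _).trans (reaches_weight r l R)).trans (reaches_x0_inv _ _ _)

theorem reaches_totalWeight (T : BTree) : Reaches (totalWeight T) (vine T.numNodes) T := by
  cases T with
  | nil => exact .refl _
  | node _ l r =>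
    have e : (BinaryTree.node () l r).numNodes = l.numLeaves + r.numNodes := by
      rw [BinaryTree.numNodes, BinaryTree.numLeaves_eq_numNodes_succ]; omega
    rw [e, vine_add]
    exact (reaches_leftWeight l _).trans (reaches_rightWeight r l)

theorem mapsOuter_one_vine (k n : ℕ) : MapsOuter 1 (vine k) (List.replicate n true) n := by
  induction k generalizing n with
  | zero => exact mapsCone_one _
  | succ k ih =>
    refine ⟨mapsCone_one _, ?_⟩
    rw [← List.replicate_succ']
    exact ih (n + 1)

theorem exists_word_mapsOuter (T : BTree) : ∃ w : List F, w.length = totalWeight T ∧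
    (∀ s ∈ w, s ∈ ({x0, x1} : Set F) ∨ s⁻¹ ∈ ({x0, x1} : Set F)) ∧
      MapsOuter (w.prod : F) T [] 0 := by
  obtain ⟨w, h, hw, H⟩ := reaches_totalWeight T
  exact ⟨w, h, hw, by simpa using H 1 (mapsOuter_one_vine _ 0)⟩

/-! ### The lower bound for the word length -/

/-- The left endpoint of the standard dyadic interval with address `u`. -/
noncomputable def coneLeft (u : List Bool) : unitInterval :=
  ⟨(cone u).1, (cone_bounds u).1, by linarith [cone_bounds u]⟩

theorem MapsCone.apply_coneLeft {f : unitInterval ≃ₜ unitInterval} {u v : List Bool}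
    (h : MapsCone f u v) : f (coneLeft u) = coneLeft v :=
  Subtype.ext (h.apply_fst rfl)

theorem coneLeft_append_false (u : List Bool) : coneLeft (u ++ [false]) = coneLeft u :=
  Subtype.ext (cone_append_false_fst u)

theorem coneLeft_append_replicate_false (u : List Bool) (j : ℕ) :
    coneLeft (u ++ List.replicate j false) = coneLeft u :=
  Subtype.ext (cone_append_replicate_false_fst u j)

theorem coneLeft_append_true_injective {u v : List Bool}
    (h : coneLeft (u ++ [true]) = coneLeft (v ++ [true])) : u = v :=
  subcone_append_true_fst_injective u zero_lt_one v (congrArg Subtype.val h)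

/-- The `n`-th breakpoint of a long right vine. -/
noncomputable def vinePoint (n : ℕ) : unitInterval := coneLeft (List.replicate n true)

theorem vinePoint_injective : Function.Injective vinePoint := by
  intro m n h
  have h' : (cone (List.replicate m true)).1 = (cone (List.replicate n true)).1 :=
    congrArg Subtype.val h
  rw [cone_replicate_true, cone_replicate_true] at h'
  exact (pow_right_injective₀ (by norm_num : (0 : ℝ) < 1 / 2) (by norm_num)) (by simpa using h')

/-- The breakpoints of a right vine to the right of `1/2`. -/
def OnRight (t : unitInterval) : Prop := ∃ m, t = vinePoint (m + 2)

/-- The breakpoints `1/2, 1/4, 1/8, …` of left vines. -/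
def OnLeft (t : unitInterval) : Prop := ∃ j, t = coneLeft (List.replicate j false ++ [true])

/-- The homeomorphism `s` lets a breakpoint enter or leave the set `OnRight` only at `q`, and
respects the linear structure next to all other breakpoints. -/
structure IsPivot (s : unitInterval ≃ₜ unitInterval) (q : unitInterval) : Prop where
  onRight_iff : ∀ t, OnRight (s t) ↔ (OnRight t ↔ t ≠ q)
  right_right : ∀ m, vinePoint (m + 2) ≠ q →
    ∃ m', MapsCone s (List.replicate (m + 2) true) (List.replicate (m' + 2) true)
  right_pivot : ∀ m, vinePoint (m + 2) = q →
    OnLeft (s q) ∨ ∃ u, MapsCone s (vineLeaf (m + 2)) (u ++ [true])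
  left_left : ∀ t, OnLeft t → t ≠ q → OnLeft (s t)
  inner_inner : ∀ u, OnLeft (coneLeft (u ++ [true])) ∨ coneLeft (u ++ [true]) = q ∨
    ∃ u', MapsCone s (u ++ [true]) (u' ++ [true])

theorem onLeft_half : OnLeft (coneLeft [true]) := ⟨0, rfl⟩

section Shift

variable {s : unitInterval ≃ₜ unitInterval} {q : unitInterval}
  (hs : ∀ m, MapsCone s (List.replicate (m + 2) true) (List.replicate (m + 3) true))
  (hq : s q = vinePoint 2)

include hs

theorem shift_vinePoint (m : ℕ) : s (vinePoint (m + 2)) = vinePoint (m + 3) :=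
  (hs m).apply_coneLeft

include hq

theorem vinePoint_ne_of_shift (m : ℕ) : vinePoint (m + 2) ≠ q := by
  intro h
  have := vinePoint_injective ((shift_vinePoint hs m).symm.trans ((congrArg s h).trans hq))
  omega

/-- `s` shifts `3/4, 7/8, …` one step along, so nothing leaves the set and the only newcomer is the
preimage `q` of `3/4`. -/
theorem onRight_shift_iff (t : unitInterval) : OnRight (s t) ↔ (OnRight t ↔ t ≠ q) := by
  constructor
  · rintro ⟨_ | m, h⟩
    · obtain rfl := s.injective (h.trans hq.symm)
      refine iff_of_false ?_ (not_not.mpr rfl)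
      rintro ⟨m, hm⟩
      exact vinePoint_ne_of_shift hs hq m hm.symm
    · obtain rfl := s.injective (h.trans (shift_vinePoint hs m).symm)
      exact iff_of_true ⟨m, rfl⟩ (vinePoint_ne_of_shift hs hq m)
  · intro h
    by_cases ht : t = q
    · exact ⟨0, by rw [ht, hq]⟩
    · obtain ⟨m, rfl⟩ := h.mpr ht
      exact ⟨m + 1, shift_vinePoint hs m⟩

theorem onRight_shift_inv_iff (t : unitInterval) :
    OnRight (s⁻¹ t) ↔ (OnRight t ↔ t ≠ vinePoint 2) := by
  obtain ⟨t, rfl⟩ := s.surjective t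
  have e : s⁻¹ (s t) = t := s.symm_apply_apply t
  have e' : s t = vinePoint 2 ↔ t = q := by rw [← hq, s.injective.eq_iff]
  simp only [e, onRight_shift_iff hs hq, ne_eq, e']
  tauto

end Shift

/-- The pivot is `1/2`, sent to `3/4`. For `x0⁻¹` it is `3/4`, sent back to `1/2`, hence onto the
left vine. -/
theorem isPivot_x0 : IsPivot x0 (vinePoint 1) where
  onRight_iff := onRight_shift_iff (fun m => (mapsCone_x0 (List.replicate (m + 1) true)).2.2)
    (mapsCone_x0 []).2.2.apply_coneLeft
  right_right m _ := ⟨m + 1, (mapsCone_x0 (List.replicate (m + 1) true)).2.2⟩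
  right_pivot m h := absurd (vinePoint_injective h) (by omega)
  left_left := by
    rintro t ⟨_ | _ | j, rfl⟩ hne
    · exact absurd rfl hne
    · refine ⟨0, ?_⟩
      exact (mapsCone_x0 []).2.1.apply_coneLeft.trans (coneLeft_append_false [true])
    · exact ⟨j + 1, (mapsCone_x0 (List.replicate j false ++ [true])).1.apply_coneLeft⟩
  inner_inner := by
    rintro (_ | ⟨_ | _, _ | ⟨_ | _, u⟩⟩)
    · exact .inl onLeft_half
    · exact .inl ⟨1, rfl⟩
    · exact .inr (.inr ⟨false :: u, (mapsCone_x0 _).1⟩)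
    · exact .inr (.inr ⟨true :: false :: u, (mapsCone_x0 _).2.1⟩)
    · exact .inr (.inr ⟨[true, true], (mapsCone_x0 _).2.2⟩)
    · exact .inr (.inr ⟨true :: true :: false :: u, (mapsCone_x0 _).2.2⟩)
    · exact .inr (.inr ⟨true :: true :: true :: u, (mapsCone_x0 _).2.2⟩)

theorem isPivot_x0_inv : IsPivot (x0⁻¹ : F) (vinePoint 2) where
  onRight_iff := onRight_shift_inv_iff
    (fun m => (mapsCone_x0 (List.replicate (m + 1) true)).2.2)
    (mapsCone_x0 []).2.2.apply_coneLeft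
  right_right m h := by
    rcases m with _ | m
    · exact absurd rfl h
    · exact ⟨m, (mapsCone_x0_inv (List.replicate (m + 1) true)).2.2⟩
  right_pivot m _ := .inl ⟨0, (mapsCone_x0_inv []).2.2.apply_coneLeft⟩
  left_left := by
    rintro t ⟨_ | j, rfl⟩ _
    · refine ⟨1, ?_⟩
      change (x0⁻¹ : F).1 (coneLeft [true]) = _
      rw [← coneLeft_append_false]
      exact (mapsCone_x0_inv []).2.1.apply_coneLeft
    · exact ⟨j + 2, (mapsCone_x0_inv (List.replicate j false ++ [true])).1.apply_coneLeft⟩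
  inner_inner := by
    rintro (_ | ⟨_ | _, _ | ⟨_ | _, u⟩⟩)
    · exact .inl onLeft_half
    · exact .inr (.inr ⟨[false, false], (mapsCone_x0_inv _).1⟩)
    · exact .inr (.inr ⟨false :: false :: false :: u, (mapsCone_x0_inv _).1⟩)
    · exact .inr (.inr ⟨false :: false :: true :: u, (mapsCone_x0_inv _).1⟩)
    · exact .inr (.inr ⟨[], (mapsCone_x0_inv _).2.2⟩)
    · exact .inr (.inr ⟨false :: true :: u, (mapsCone_x0_inv _).2.1⟩)
    · exact .inr (.inr ⟨true :: u, (mapsCone_x0_inv _).2.2⟩)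

/-- The pivot is `5/8`, sent to `3/4`. For `x1⁻¹` it is `3/4`, sent to `5/8`; there the vine leaf
`110` lands on `101`, a right half. -/
theorem isPivot_x1 : IsPivot x1 (coneLeft [true, false, true]) where
  onRight_iff := onRight_shift_iff (fun m => (mapsCone_x1 (List.replicate m true)).2.2.2)
    ((mapsCone_x1 []).2.2.1.apply_coneLeft.trans (coneLeft_append_false [true, true]))
  right_right m _ := ⟨m + 1, (mapsCone_x1 (List.replicate m true)).2.2.2⟩
  right_pivot m h := by
    rw [vinePoint, List.replicate_succ'] at h
    have := coneLeft_append_true_injective (v := [true, false]) h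
    rcases m with _ | _ | m <;> simp [List.replicate_succ] at this
  left_left := by
    rintro t ⟨_ | j, rfl⟩ _
    · refine ⟨0, ?_⟩
      have h := (mapsCone_x1 []).2.1.apply_coneLeft
      rwa [show [true, false, false] = [true] ++ List.replicate 2 false from rfl,
        coneLeft_append_replicate_false, show [true, false] = [true] ++ [false] from rfl,
        coneLeft_append_false] at h
    · exact ⟨j + 1, (mapsCone_x1 (List.replicate j false ++ [true])).1.apply_coneLeft⟩
  inner_inner := by
    rintro (_ | ⟨_ | _, u⟩)
    · exact .inl onLeft_half
    · exact .inr (.inr ⟨false :: u, (mapsCone_x1 _).1⟩)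
    · rcases u with _ | ⟨_ | _, u⟩
      · exact .inr (.inr ⟨[true, true], (mapsCone_x1 _).2.2.2⟩)
      · rcases u with _ | ⟨_ | _, u⟩
        · exact .inr (.inl rfl)
        · exact .inr (.inr ⟨true :: false :: u, (mapsCone_x1 _).2.1⟩)
        · exact .inr (.inr ⟨true :: true :: false :: u, (mapsCone_x1 _).2.2.1⟩)
      · exact .inr (.inr ⟨true :: true :: true :: u, (mapsCone_x1 _).2.2.2⟩)

theorem isPivot_x1_inv : IsPivot (x1⁻¹ : F) (vinePoint 2) where
  onRight_iff := onRight_shift_inv_iff (fun m => (mapsCone_x1 (List.replicate m true)).2.2.2)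
    ((mapsCone_x1 []).2.2.1.apply_coneLeft.trans (coneLeft_append_false [true, true]))
  right_right m h := by
    rcases m with _ | m
    · exact absurd rfl h
    · exact ⟨m, (mapsCone_x1_inv (List.replicate m true)).2.2.2⟩
  right_pivot m h := by
    obtain rfl : m = 0 := by
      have := vinePoint_injective h
      omega
    exact .inr ⟨[true, false], (mapsCone_x1_inv []).2.2.1⟩
  left_left := by
    rintro t ⟨_ | j, rfl⟩ _
    · refine ⟨0, ?_⟩
      have h := (mapsCone_x1_inv []).2.1.apply_coneLeft
      rwa [show [true, false, false] = [true] ++ List.replicate 2 false from rfl,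
        coneLeft_append_replicate_false, show [true, false] = [true] ++ [false] from rfl,
        coneLeft_append_false] at h
    · exact ⟨j + 1, (mapsCone_x1_inv (List.replicate j false ++ [true])).1.apply_coneLeft⟩
  inner_inner := by
    rintro (_ | ⟨_ | _, u⟩)
    · exact .inl onLeft_half
    · exact .inr (.inr ⟨false :: u, (mapsCone_x1_inv _).1⟩)
    · rcases u with _ | ⟨_ | _, u⟩
      · exact .inr (.inl rfl)
      · exact .inr (.inr ⟨true :: false :: false :: u, (mapsCone_x1_inv _).2.1⟩)
      · rcases u with _ | ⟨_ | _, u⟩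
        · exact .inr (.inr ⟨[true], (mapsCone_x1_inv _).2.2.2⟩)
        · exact .inr (.inr ⟨true :: false :: true :: u, (mapsCone_x1_inv _).2.2.1⟩)
        · exact .inr (.inr ⟨true :: true :: u, (mapsCone_x1_inv _).2.2.2⟩)

/-- What is known about the image under `h` of the `n`-th breakpoint of the right vine, when it has
met `c` pivots. -/
structure HasCost (h : unitInterval ≃ₜ unitInterval) (n c : ℕ) : Prop where
  even_iff : Even c ↔ OnRight (h (vinePoint n))
  of_zero : c = 0 → ∃ m, MapsCone h (List.replicate n true) (List.replicate (m + 2) true)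
  of_one : c = 1 → OnLeft (h (vinePoint n)) ∨ ∃ u, MapsCone h (vineLeaf n) (u ++ [true])

theorem coneLeft_vineLeaf (n : ℕ) : coneLeft (vineLeaf n) = vinePoint n :=
  coneLeft_append_false _

-- The charge grows exactly when the breakpoint sits on the pivot, where membership in `OnRight`
-- flips. At the first charge the linearity known for charge 0 is still available, so `right_pivot`
-- applies; uncharged letters preserve its outcome by `left_left` and `inner_inner`.
open Classical in
theorem HasCost.step {s h : unitInterval ≃ₜ unitInterval} {q : unitInterval} {n c : ℕ}
    (hs : IsPivot s q) (hh : HasCost h n c) :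
    HasCost (s * h) n (c + if h (vinePoint n) = q then 1 else 0) := by
  have e : (s * h) (vinePoint n) = s (h (vinePoint n)) := rfl
  split_ifs with hq
  · refine ⟨?_, fun h => absurd h (by omega), fun hc => ?_⟩
    · rw [e, hs.onRight_iff, Nat.even_add_one, hh.even_iff]
      tauto
    · obtain ⟨m, hm⟩ := hh.of_zero (by omega)
      have hm' : vinePoint (m + 2) = q := hm.apply_coneLeft.symm.trans hq
      rw [e, hq]
      rcases hs.right_pivot m hm' with h1 | ⟨u, hu⟩
      · exact .inl h1
      · exact .inr ⟨u, (hm.append [false]).comp hu⟩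
  · refine ⟨?_, fun hc => ?_, fun hc => ?_⟩
    · rw [e, hs.onRight_iff, add_zero, hh.even_iff]
      tauto
    · obtain ⟨m, hm⟩ := hh.of_zero hc
      obtain ⟨m', hm'⟩ := hs.right_right m fun h => hq (hm.apply_coneLeft.trans h)
      exact ⟨m', hm.comp hm'⟩
    · rw [e]
      rcases hh.of_one hc with h1 | ⟨u, hu⟩
      · exact .inl (hs.left_left _ h1 hq)
      · have hu' : h (vinePoint n) = coneLeft (u ++ [true]) := by
          rw [← hu.apply_coneLeft, coneLeft_vineLeaf]
        rcases hs.inner_inner u with h1 | h1 | ⟨u', h1⟩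
        · exact .inl (hs.left_left _ (hu' ▸ h1) hq)
        · exact absurd (hu'.trans h1) hq
        · exact .inr ⟨u', hu.comp h1⟩

theorem hasCost_one {n : ℕ} (hn : 2 ≤ n) : HasCost 1 n 0 := by
  obtain ⟨m, rfl⟩ := Nat.exists_eq_add_of_le' hn
  exact ⟨iff_of_true (by simp) ⟨m, rfl⟩, fun _ => ⟨m, mapsCone_one _⟩,
    fun h => absurd h (by omega)⟩

theorem exists_isPivot {s : F} (hs : s ∈ ({x0, x1} : Set F) ∨ s⁻¹ ∈ ({x0, x1} : Set F)) :
    ∃ q, IsPivot s q := by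
  rcases hs with (rfl | rfl) | (hs | hs)
  · exact ⟨_, isPivot_x0⟩
  · exact ⟨_, isPivot_x1⟩
  · obtain rfl := inv_eq_iff_eq_inv.mp hs
    exact ⟨_, isPivot_x0_inv⟩
  · obtain rfl := inv_eq_iff_eq_inv.mp hs
    exact ⟨_, isPivot_x1_inv⟩

-- Distinct breakpoints have distinct images, so at most one of them sits on the pivot of a given
-- letter.
open Classical in
theorem exists_cost (w : List F)
    (hw : ∀ s ∈ w, s ∈ ({x0, x1} : Set F) ∨ s⁻¹ ∈ ({x0, x1} : Set F)) :
    ∃ c : ℕ → ℕ, (∀ s : Finset ℕ, ∑ n ∈ s, c n ≤ w.length) ∧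
      ∀ n, 2 ≤ n → HasCost (w.prod : F) n (c n) := by
  induction w with
  | nil => exact ⟨0, by simp, fun n hn => hasCost_one hn⟩
  | cons s w ih =>
    obtain ⟨c, hc, H⟩ := ih fun t ht => hw t (List.mem_cons_of_mem _ ht)
    obtain ⟨q, hq⟩ := exists_isPivot (hw s List.mem_cons_self)
    refine ⟨fun n => c n + if (w.prod : F).1 (vinePoint n) = q then 1 else 0, fun S => ?_,
      fun n hn => ?_⟩
    · rw [Finset.sum_add_distrib, List.length_cons]
      refine add_le_add (hc S) ?_
      rw [← Finset.card_filter, Finset.card_le_one]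
      intro a ha b hb
      rw [Finset.mem_filter] at ha hb
      exact vinePoint_injective ((w.prod : F).1.injective (ha.2.trans hb.2.symm))
    · rw [List.prod_cons]
      exact (H n hn).step hq

/-! ### Comparing costs and weights -/

theorem not_onRight_of_mem {u : List Bool} (h : false ∈ u) : ¬ OnRight (coneLeft (u ++ [true])) := by
  rintro ⟨m, hm⟩
  rw [vinePoint, List.replicate_succ'] at hm
  rw [coneLeft_append_true_injective hm] at h
  simp at h

theorem not_onLeft_of_mem {u : List Bool} (h : true ∈ u) : ¬ OnLeft (coneLeft (u ++ [true])) := by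
  rintro ⟨j, hj⟩
  rw [coneLeft_append_true_injective hj] at h
  simp at h

theorem not_onRight_of_onLeft {t : unitInterval} (h : OnLeft t) : ¬ OnRight t := by
  rintro ⟨m, rfl⟩
  rw [vinePoint, List.replicate_succ'] at h
  exact not_onLeft_of_mem (by simp) h

theorem MapsInner.apply_vinePoint {g : unitInterval ≃ₜ unitInterval} {S : BTree} {u : List Bool}
    {n : ℕ} (h : MapsInner g S u n) : g (vinePoint n) = coneLeft u := by
  obtain ⟨j, hj, -⟩ := h.first
  rw [← coneLeft_vineLeaf, hj.apply_coneLeft, coneLeft_append_replicate_false]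

theorem MapsOuter.apply_vinePoint {g : unitInterval ≃ₜ unitInterval} {S : BTree} {u : List Bool}
    {n : ℕ} (h : MapsOuter g S u n) : g (vinePoint n) = coneLeft u := by
  induction S generalizing u n with
  | nil => exact MapsCone.apply_coneLeft h
  | node _ l r _ _ => rw [h.1.apply_vinePoint, coneLeft_append_false]

/-- The first leaf of a nontrivial tree is a left leg, so its address ends in `false`. -/
theorem MapsInner.not_mapsCone_append_true {g : unitInterval ≃ₜ unitInterval} {S : BTree}
    {u v : List Bool} {n : ℕ} (h : MapsInner g S u n) (hS : S ≠ leaf) :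
    ¬ MapsCone g (vineLeaf n) (v ++ [true]) := by
  intro hv
  obtain ⟨_ | j, hj, hj'⟩ := h.first
  · exact hS (hj' rfl)
  · have := hv.right_unique hj
    rw [List.replicate_succ', ← List.append_assoc] at this
    simpa using (List.append_inj' this rfl).2

theorem numLeaves_pos (S : BTree) : 1 ≤ S.numLeaves := by
  rw [BinaryTree.numLeaves_eq_numNodes_succ]; omega

theorem sum_Ico_split (c : ℕ → ℕ) (n a b : ℕ) (ha : 1 ≤ a) (hb : 1 ≤ b) :
    ∑ i ∈ Finset.Ico (n + 1) (n + (a + b)), c i = ∑ i ∈ Finset.Ico (n + 1) (n + a), c i +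
      c (n + a) + ∑ i ∈ Finset.Ico (n + a + 1) (n + a + b), c i := by
  rw [← Finset.sum_Ico_consecutive c (show n + 1 ≤ n + a by omega)
    (show n + a ≤ n + (a + b) by omega), Finset.sum_eq_sum_Ico_succ_bot (show n + a < _ by omega)]
  ring_nf

section Costs

variable {g : unitInterval ≃ₜ unitInterval} {c : ℕ → ℕ} (hc : ∀ n, 2 ≤ n → HasCost g n (c n))

include hc

/-- A caret is charged to its midpoint, the image of breakpoint `n + l.numLeaves`. Since `u`
contains both letters, this point is on neither vine: the charge is odd, and charge 1 would force
the first leaf of `r` to be a right half, hence `r` to be a leaf. -/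
theorem weight_le_sum (S : BTree) {u : List Bool} {n : ℕ} (hn : 1 ≤ n)
    (hu : false ∈ u) (hu' : true ∈ u) (h : MapsInner g S u n) :
    weight S ≤ ∑ i ∈ Finset.Ico (n + 1) (n + S.numLeaves), c i := by
  induction S generalizing u n with
  | nil => simp [weight]
  | node _ l r ihl ihr =>
    have hl := ihl hn (List.mem_append_left _ hu) (List.mem_append_left _ hu') h.1
    have hr := ihr (by omega) (List.mem_append_left _ hu) (List.mem_append_left _ hu') h.2
    have hd := hc (n + l.numLeaves) (by have := numLeaves_pos l; omega)
    rw [BinaryTree.numLeaves, sum_Ico_split c n _ _ (numLeaves_pos l) (numLeaves_pos r), weight]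
    have hodd : ¬ Even (c (n + l.numLeaves)) := by
      rw [hd.even_iff, h.2.apply_vinePoint]
      exact not_onRight_of_mem hu
    split_ifs with hleaf
    · have : c (n + l.numLeaves) ≠ 0 := fun h0 => hodd (by rw [h0]; exact Even.zero)
      omega
    · have h1 : c (n + l.numLeaves) ≠ 1 := by
        intro h1
        rcases hd.of_one h1 with h2 | ⟨v, hv⟩
        · rw [h.2.apply_vinePoint] at h2
          exact not_onLeft_of_mem hu' h2
        · exact h.2.not_mapsCone_append_true hleaf hv
      rw [Nat.not_even_iff] at hodd
      omega

/-- Left-spine carets are charged to their right ends, which lie on the left vine and so have odd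
charge. Starting the sum at `n + 2` skips the right end of the bottom leaf of the spine, which costs
nothing. -/
theorem leftWeight_le_sum (S : BTree) {j n : ℕ}
    (h : MapsInner g S (List.replicate (j + 1) false) n)
    (hend : OnLeft (g (vinePoint (n + S.numLeaves)))) :
    leftWeight S ≤ ∑ i ∈ Finset.Ico (n + 2) (n + S.numLeaves + 1), c i := by
  induction S generalizing j n with
  | nil => simp [leftWeight]
  | node _ l r ihl _ =>
    have h1 := h.1
    rw [← List.replicate_succ'] at h1
    have hpl := numLeaves_pos l
    have hpr := numLeaves_pos r
    have hl := ihl h1 ⟨j + 1, h.2.apply_vinePoint⟩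
    have hr := weight_le_sum hc r (by omega) (by simp) (by simp) h.2
    rw [BinaryTree.numLeaves, ← add_assoc] at hend ⊢
    have hd := hc (n + l.numLeaves + r.numLeaves) (by omega)
    have h0 : c (n + l.numLeaves + r.numLeaves) ≠ 0 := by
      intro h0
      refine not_onRight_of_onLeft hend (hd.even_iff.mp ?_)
      rw [h0]
      exact Even.zero
    rw [Finset.sum_Ico_succ_top (by omega), ← Finset.sum_Ico_consecutive c
      (show n + 2 ≤ n + l.numLeaves + 1 by omega) (by omega), leftWeight]
    omega

/-- Midpoints on the right spine stay in `OnRight`, so their charge is even; charge 0 would make `g`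
linear on the tail and the reduced tree `r` a leaf. -/
theorem rightWeight_le_sum (S : BTree) (hS : RightReduced S) {j n : ℕ} (hn : 1 ≤ n)
    (h : MapsOuter g S (List.replicate (j + 1) true) n) :
    rightWeight S ≤ ∑ i ∈ Finset.Ico (n + 1) (n + S.numLeaves), c i := by
  induction S generalizing j n with
  | nil => simp [rightWeight]
  | node _ l r _ ihr =>
    have hl := weight_le_sum hc l hn (by simp) (by simp) h.1
    have h2 := h.2
    rw [← List.replicate_succ'] at h2
    have hr := ihr hS.1 (by omega) h2
    have hd := hc (n + l.numLeaves) (by have := numLeaves_pos l; omega)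
    rw [BinaryTree.numLeaves, sum_Ico_split c n _ _ (numLeaves_pos l) (numLeaves_pos r),
      rightWeight]
    split_ifs with hleaf
    · omega
    · have heven : Even (c (n + l.numLeaves)) := hd.even_iff.mpr ⟨j, h2.apply_vinePoint⟩
      have h0 : c (n + l.numLeaves) ≠ 0 := by
        intro h0
        obtain ⟨m, hm⟩ := hd.of_zero h0
        have e : vinePoint (m + 2) = vinePoint (j + 2) :=
          hm.apply_coneLeft.symm.trans h2.apply_vinePoint
        rw [vinePoint_injective e] at hm
        exact hleaf (h2.eq_leaf hS.1 hm)
      rw [Nat.even_iff] at heven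
      omega

end Costs

theorem totalWeight_le_length {w : List F} {T : BTree}
    (hw : ∀ s ∈ w, s ∈ ({x0, x1} : Set F) ∨ s⁻¹ ∈ ({x0, x1} : Set F)) (hT : RightReduced T)
    (h : MapsOuter (w.prod : F) T [] 0) : totalWeight T ≤ w.length := by
  obtain ⟨c, hsum, hc⟩ := exists_cost w hw
  cases T with
  | nil => exact Nat.zero_le _
  | node _ l r =>
    have hpl := numLeaves_pos l
    have hpr := numLeaves_pos r
    have h2 := h.2
    have hl := leftWeight_le_sum hc l (j := 0) h.1 ⟨0, h2.apply_vinePoint⟩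
    have hr := rightWeight_le_sum hc r hT.1 (j := 0) (by omega) h2
    have hs := hsum (Finset.Ico 2 (l.numLeaves + r.numLeaves))
    rw [zero_add] at hr hl
    -- The two subtrees of the root draw on disjoint ranges of breakpoints, so their bounds add.
    rw [← Finset.sum_Ico_consecutive c (show 2 ≤ l.numLeaves + 1 by omega) (by omega)] at hs
    rw [zero_add] at hl
    rw [totalWeight]
    omega

theorem exists_word_inv {w : List F}
    (hw : ∀ s ∈ w, s ∈ ({x0, x1} : Set F) ∨ s⁻¹ ∈ ({x0, x1} : Set F)) :
    ∃ w' : List F, w'.length = w.length ∧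
      (∀ s ∈ w', s ∈ ({x0, x1} : Set F) ∨ s⁻¹ ∈ ({x0, x1} : Set F)) ∧ w'.prod = w.prod⁻¹ := by
  refine ⟨(w.map (·⁻¹)).reverse, by simp, ?_, (List.prod_inv_reverse w).symm⟩
  intro s hs
  obtain ⟨t, ht, rfl⟩ := List.mem_map.mp (List.mem_reverse.mp hs)
  rw [inv_inv]
  exact (hw t ht).symm

theorem hasLength_totalWeight {f : F} {T : BTree} (hT : RightReduced T)
    (h : MapsOuter (f⁻¹ : F) T [] 0) : HasLength {x0, x1} f (totalWeight T) := by
  constructor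
  · obtain ⟨w, hlen, hw, H⟩ := exists_word_mapsOuter T
    obtain ⟨w', hlen', hw', e⟩ := exists_word_inv hw
    refine ⟨w', hlen'.trans hlen, hw', ?_⟩
    rw [e, inv_eq_iff_eq_inv]
    exact Subtype.ext (H.homeo_unique h)
  · rintro m ⟨w, rfl, hw, rfl⟩
    obtain ⟨w', hlen, hw', e⟩ := exists_word_inv hw
    rw [← hlen]
    rw [← e] at h
    exact totalWeight_le_length hw' hT h

/-- Positive elements of length `n` correspond to reduced trees of weight `n`. -/
theorem exists_bijOn_positiveOfLength : ∃ φ : BTree → F, ∀ n,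
    Set.BijOn φ {T | RightReduced T ∧ totalWeight T = n} (positiveOfLength n) := by
  choose w _ _ hw using exists_word_mapsOuter
  have hφ : ∀ T, MapsOuter ((((w T).prod⁻¹)⁻¹ : F) : unitInterval ≃ₜ unitInterval) T [] 0 :=
    fun T => by rw [inv_inv]; exact hw T
  refine ⟨fun T => (w T).prod⁻¹, fun n => ⟨?_, ?_, ?_⟩⟩
  · rintro T ⟨hT, rfl⟩
    exact ⟨(isPositive_iff _).mpr ⟨T, hT, hφ T⟩, hasLength_totalWeight hT (hφ T)⟩
  · rintro T ⟨hT, -⟩ T' ⟨hT', -⟩ e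
    have e' : (w T).prod = (w T').prod := inv_injective e
    have h' := hw T'
    rw [← e'] at h'
    exact (hw T).unique h' hT hT'
  · rintro f ⟨hf, hlen⟩
    obtain ⟨T, hT, h⟩ := (isPositive_iff f).mp hf
    refine ⟨T, ⟨hT, (hasLength_totalWeight hT h).unique hlen⟩, ?_⟩
    change (w T).prod⁻¹ = f
    rw [inv_eq_iff_eq_inv]
    exact Subtype.ext ((hw T).homeo_unique h)

/-! ### Generating functions of weighted classes -/

/-- The weight `w` takes each value only finitely often. -/
def FiniteFibers {α : Type} (w : α → ℕ) : Prop := ∀ n, {a | w a = n}.Finite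

/-- The generating function of a class of objects with respect to a weight. -/
noncomputable def genFun {α : Type} (w : α → ℕ) : ℚ⟦X⟧ :=
  PowerSeries.mk fun n => ({a | w a = n}.ncard : ℚ)

theorem finiteFibers_of_le {α : Type} {w w' : α → ℕ} (h : FiniteFibers w)
    (φ : ℕ → ℕ) (hw : ∀ a, w a ≤ φ (w' a)) : FiniteFibers w' := by
  intro n
  refine ((Set.finite_Iic (φ n)).biUnion fun m _ => h m).subset fun a ha => ?_
  simp only [Set.mem_iUnion, Set.mem_ofPred_eq, exists_prop, exists_eq_right']
  rw [Set.mem_Iic, ← show w' a = n from ha]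
  exact hw a

theorem FiniteFibers.comp {α β : Type} {w : β → ℕ} (h : FiniteFibers w) {φ : α → β}
    (hφ : Function.Injective φ) : FiniteFibers fun a => w (φ a) := fun n =>
  (h n).preimage hφ.injOn

theorem FiniteFibers.prod {α β : Type} {v : α → ℕ} {w : β → ℕ} (hv : FiniteFibers v)
    (hw : FiniteFibers w) : FiniteFibers fun x : α × β => v x.1 + w x.2 := by
  intro n
  refine ((Finset.HasAntidiagonal.antidiagonal n).finite_toSet.biUnion
    fun m _ => (hv m.1).prod (hw m.2)).subset fun x hx => ?_
  simp only [Set.mem_iUnion]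
  exact ⟨(v x.1, w x.2), by simpa using hx, rfl, rfl⟩

theorem genFun_equiv {α β : Type} (e : α ≃ β) {v : α → ℕ} {w : β → ℕ} (h : ∀ a, w (e a) = v a) :
    genFun v = genFun w := by
  ext n
  simp only [genFun, coeff_mk, Nat.cast_inj]
  refine Set.ncard_congr (fun a _ => e a) (fun a ha => (h a).trans ha)
    (fun a b _ _ hab => e.injective hab) fun b hb => ⟨e.symm b, ?_, by simp⟩
  change v (e.symm b) = n
  rw [← h, e.apply_symm_apply]
  exact hb

theorem genFun_sum {α β : Type} {v : α → ℕ} {w : β → ℕ} (hv : FiniteFibers v)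
    (hw : FiniteFibers w) : genFun (Sum.elim v w) = genFun v + genFun w := by
  ext n
  simp only [genFun, coeff_mk, map_add]
  have : {a | Sum.elim v w a = n} = Sum.inl '' {a | v a = n} ∪ Sum.inr '' {a | w a = n} := by
    ext (a | a) <;> simp
  rw [this, Set.ncard_union_eq ?_ ((hv n).image _) ((hw n).image _), Set.ncard_image_of_injective _ Sum.inl_injective,
    Set.ncard_image_of_injective _ Sum.inr_injective, Nat.cast_add]
  · rw [Set.disjoint_left]
    rintro _ ⟨a, _, rfl⟩ ⟨b, _, h⟩
    exact absurd h (by simp)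

theorem genFun_prod {α β : Type} {v : α → ℕ} {w : β → ℕ} (hv : FiniteFibers v)
    (hw : FiniteFibers w) :
    genFun (fun x : α × β => v x.1 + w x.2) = genFun v * genFun w := by
  ext n
  simp only [genFun, coeff_mk, coeff_mul]
  classical
  have e : {x : α × β | v x.1 + w x.2 = n} =
      ((Finset.HasAntidiagonal.antidiagonal n).biUnion fun m => (hv m.1).toFinset ×ˢ (hw m.2).toFinset) := by
    ext x
    simp only [Set.mem_ofPred_eq, Finset.mem_coe, Finset.mem_biUnion, Finset.mem_product,
      Set.Finite.mem_toFinset, Finset.HasAntidiagonal.mem_antidiagonal]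
    constructor
    · exact fun h => ⟨(v x.1, w x.2), h, rfl, rfl⟩
    · rintro ⟨m, hm, h1, h2⟩
      rw [h1, h2, hm]
  rw [e, Set.ncard_coe_finset, Finset.card_biUnion, Nat.cast_sum]
  · refine Finset.sum_congr rfl fun m _ => ?_
    rw [Finset.card_product, Nat.cast_mul, ← Set.ncard_eq_toFinset_card _ (hv m.1),
      ← Set.ncard_eq_toFinset_card _ (hw m.2)]
  · intro m _ m' _ hne
    rw [Function.onFun, Finset.disjoint_left]
    intro x hx hx'
    simp only [Finset.mem_product, Set.Finite.mem_toFinset, Set.mem_ofPred_eq] at hx hx'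
    exact hne (Prod.ext (hx.1.symm.trans hx'.1) (hx.2.symm.trans hx'.2))

theorem finiteFibers_unit (k : ℕ) : FiniteFibers fun _ : Unit => k := fun _ => Set.toFinite _

theorem genFun_unit (k : ℕ) : genFun (fun _ : Unit => k) = (X : ℚ⟦X⟧) ^ k := by
  ext n
  rw [genFun, coeff_mk, coeff_X_pow]
  by_cases h : n = k
  · subst h
    simp [Set.ncard_univ]
  · have : {_a : Unit | k = n} = ∅ := by
      ext
      simp [Ne.symm h]
    simp [h, this]

theorem FiniteFibers.add_const {α : Type} {w : α → ℕ} (hw : FiniteFibers w) (k : ℕ) :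
    FiniteFibers fun a => w a + k :=
  finiteFibers_of_le hw id fun _ => Nat.le_add_right _ _

theorem genFun_add_const {α : Type} {w : α → ℕ} (hw : FiniteFibers w) (k : ℕ) :
    genFun (fun a => w a + k) = genFun w * X ^ k := by
  rw [← genFun_unit, ← genFun_prod hw (finiteFibers_unit k)]
  exact genFun_equiv (Equiv.prodPUnit α).symm fun _ => rfl

/-- Splitting off one object of weight `0`. -/
theorem genFun_ne {α : Type} {w : α → ℕ} (hw : FiniteFibers w) {a : α} (ha : w a = 0) :
    genFun w = genFun (fun b : {b // b ≠ a} => w b) + 1 := by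
  classical
  have h1 : FiniteFibers fun b : {b // b ≠ a} => w b := hw.comp Subtype.val_injective
  rw [← pow_zero (X : ℚ⟦X⟧), ← genFun_unit, ← genFun_sum h1 (finiteFibers_unit 0)]
  symm
  refine genFun_equiv
    ⟨Sum.elim Subtype.val fun _ => a, fun b => if h : b = a then .inr () else .inl ⟨b, h⟩,
      ?_, ?_⟩ ?_
  · rintro (⟨b, hb⟩ | _)
    · simp [hb]
    · simp
  · intro b
    by_cases h : b = a
    · simp [h]
    · simp [h]
  · rintro (b | _)
    · rfl
    · exact ha

/-! ### Counting trees by weight -/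

theorem finiteFibers_numNodes : FiniteFibers (BinaryTree.numNodes : BTree → ℕ) := by
  intro n
  refine (BinaryTree.treesOfNumNodesEq n).finite_toSet.subset fun T hT => ?_
  simpa [BinaryTree.mem_treesOfNumNodesEq] using hT

theorem numNodes_le_weight (T : BTree) : T.numNodes ≤ weight T := by
  induction T with
  | nil => simp
  | node _ l r ihl ihr =>
    rw [BinaryTree.numNodes, weight]
    split_ifs <;> omega

theorem numNodes_le_leftWeight (T : BTree) : T.numNodes ≤ leftWeight T := by
  induction T with
  | nil => simp
  | node _ l r ihl _ =>
    have := numNodes_le_weight r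
    rw [BinaryTree.numNodes, leftWeight]
    omega

/-- The `+ 1` accounts for the last caret of the right spine, which is free. -/
theorem numNodes_le_rightWeight {T : BTree} (hT : RightReduced T) :
    T.numNodes ≤ rightWeight T + 1 := by
  induction T with
  | nil => simp
  | node _ l r _ ihr =>
    have hl := numNodes_le_weight l
    have hr := ihr hT.1
    rw [BinaryTree.numNodes, rightWeight]
    split_ifs with h
    · subst h
      simp only [BinaryTree.numNodes] at hr ⊢
      omega
    · omega

theorem finiteFibers_weight : FiniteFibers weight :=
  finiteFibers_of_le finiteFibers_numNodes id numNodes_le_weight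

theorem finiteFibers_leftWeight : FiniteFibers leftWeight :=
  finiteFibers_of_le finiteFibers_numNodes id numNodes_le_leftWeight

/-- Trees whose right spine is reduced. -/
abbrev ReducedTree : Type := {T : BTree // RightReduced T}

/-- The single leaf as a reduced tree. -/
abbrev reducedLeaf : ReducedTree := ⟨leaf, trivial⟩

theorem finiteFibers_rightWeight : FiniteFibers fun T : ReducedTree => rightWeight T :=
  finiteFibers_of_le (finiteFibers_numNodes.comp Subtype.val_injective) (· + 1)
    fun T => numNodes_le_rightWeight T.2

/-- A nontrivial tree consists of its left and its right subtree. -/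
def caretEquiv : BTree × BTree ≃ {T : BTree // T ≠ leaf} where
  toFun x := ⟨caret x.1 x.2, by simp⟩
  invFun
    | ⟨BinaryTree.node _ l r, _⟩ => (l, r)
  left_inv _ := rfl
  right_inv
    | ⟨BinaryTree.node _ _ _, _⟩ => rfl

/-- A nontrivial reduced tree consists of its left and its right subtree, not both trivial. -/
def reducedCaretEquiv :
    {x : BTree × ReducedTree // x ≠ (leaf, reducedLeaf)} ≃ {T : ReducedTree // T ≠ reducedLeaf} where
  toFun x := ⟨⟨caret x.1.1 x.1.2, x.1.2.2, fun h => x.2 (Prod.ext h.1 (Subtype.ext h.2))⟩,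
    fun h => by simpa using congrArg Subtype.val h⟩
  invFun
    | ⟨⟨BinaryTree.node _ l r, h⟩, _⟩ => ⟨(l, ⟨r, h.1⟩), fun e => h.2
        ⟨congrArg Prod.fst e, congrArg Subtype.val (congrArg Prod.snd e)⟩⟩
    | ⟨⟨BinaryTree.nil, _⟩, h⟩ => absurd rfl h
  left_inv _ := rfl
  right_inv
    | ⟨⟨BinaryTree.node _ _ _, _⟩, _⟩ => rfl
    | ⟨⟨BinaryTree.nil, _⟩, h⟩ => absurd rfl h

/-- Splitting pairs according to whether the second component is a given object. -/
theorem genFun_prod_split {α β : Type} {v : α → ℕ} {w : β → ℕ} (hv : FiniteFibers v)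
    (hw : FiniteFibers w) {b : β} (hb : w b = 0) (k l : ℕ) [DecidableEq β] :
    genFun (fun x : α × β => v x.1 + w x.2 + if x.2 = b then k else l) =
      genFun v * (X ^ k + (genFun w - 1) * X ^ l) := by
  have hw' : FiniteFibers fun c : {c // c ≠ b} => w c := hw.comp Subtype.val_injective
  have h2 : FiniteFibers (Sum.elim (fun _ : Unit => k) fun c : {c // c ≠ b} => w c + l) := by
    intro n
    refine ((Set.toFinite (Set.range (Sum.inl : Unit → _))).union
      ((hw'.add_const l n).image Sum.inr)).subset ?_
    rintro (a | a) ha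
    · exact .inl ⟨a, rfl⟩
    · exact .inr ⟨a, ha, rfl⟩
  rw [sub_eq_of_eq_add (genFun_ne hw hb), ← genFun_add_const hw', ← genFun_unit,
    ← genFun_sum (finiteFibers_unit k) (hw'.add_const l), ← genFun_prod hv h2]
  symm
  refine genFun_equiv (Equiv.prodCongr (Equiv.refl α)
    ⟨Sum.elim (fun _ => b) Subtype.val, fun c => if h : c = b then .inl () else .inr ⟨c, h⟩,
      ?_, ?_⟩) ?_
  · rintro (_ | ⟨c, hc⟩)
    · simp
    · simp [hc]
  · intro c
    by_cases h : c = b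
    · simp [h]
    · simp [h]
  · rintro ⟨a, _ | ⟨c, hc⟩⟩
    · simp [hb]
    · simp [hc, add_assoc]

/-- The leaf gives `1`; a caret contributes `X` when its right leg is a leaf and `X ^ 3` otherwise.
-/
theorem genFun_weight :
    genFun weight = 1 + X * genFun weight + X ^ 3 * genFun weight * (genFun weight - 1) := by
  have h := genFun_prod_split finiteFibers_weight finiteFibers_weight (b := leaf) rfl 1 3
  replace h := (genFun_equiv caretEquiv (w := fun T => weight T) fun _ => rfl).symm.trans h
  conv_lhs => rw [genFun_ne finiteFibers_weight (a := leaf) rfl, h]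
  ring

theorem genFun_leftWeight :
    genFun leftWeight = 1 + X * genFun leftWeight * genFun weight := by
  have h := genFun_add_const (finiteFibers_leftWeight.prod finiteFibers_weight) 1
  replace h := (genFun_equiv caretEquiv (w := fun T => leftWeight T) fun _ => rfl).symm.trans h
  rw [genFun_prod finiteFibers_leftWeight finiteFibers_weight] at h
  conv_lhs => rw [genFun_ne finiteFibers_leftWeight (a := leaf) rfl, h]
  ring

/-- A weight of reduced trees that is determined by the two subtrees of the root. -/
theorem genFun_reducedTree {w : ReducedTree → ℕ} (hw : FiniteFibers w) (h0 : w reducedLeaf = 0)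
    {v : BTree × ReducedTree → ℕ} (hv : FiniteFibers v) (hv0 : v (leaf, reducedLeaf) = 0)
    (h : ∀ x, w (reducedCaretEquiv x) = v x) : genFun w = genFun v := by
  -- Each side sheds one object of weight 0, the leaf on the left and the forbidden pair of leaves
  -- on the right, so no correction term remains.
  rw [genFun_ne hw h0, genFun_ne hv hv0, genFun_equiv reducedCaretEquiv (w := fun T => w T) h]

theorem reducedTree_eq_iff (T : ReducedTree) : T = reducedLeaf ↔ T.1 = leaf :=
  Subtype.ext_iff

theorem genFun_rightWeight : genFun (fun T : ReducedTree => rightWeight T) =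
    genFun weight * (1 + (genFun (fun T : ReducedTree => rightWeight T) - 1) * X ^ 2) := by
  have h := genFun_prod_split finiteFibers_weight finiteFibers_rightWeight (b := reducedLeaf) rfl
    0 2
  rw [pow_zero] at h
  refine (genFun_reducedTree finiteFibers_rightWeight rfl ?_ rfl ?_).trans h
  · exact finiteFibers_of_le (finiteFibers_weight.prod finiteFibers_rightWeight) id
      fun _ => Nat.le_add_right _ _
  · rintro ⟨⟨l, r⟩, hx⟩
    simp only [reducedTree_eq_iff]
    rfl

theorem finiteFibers_totalWeight : FiniteFibers fun T : ReducedTree => totalWeight T := by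
  refine finiteFibers_of_le (finiteFibers_numNodes.comp Subtype.val_injective) (· + 2) ?_
  rintro ⟨_ | ⟨_, l, r⟩, hT⟩
  · simp
  · have := numNodes_le_leftWeight l
    have := numNodes_le_rightWeight hT.1
    simp only [BinaryTree.numNodes, totalWeight]
    omega

theorem genFun_totalWeight : genFun (fun T : ReducedTree => totalWeight T) =
    genFun leftWeight * genFun (fun T : ReducedTree => rightWeight T) := by
  rw [← genFun_prod finiteFibers_leftWeight finiteFibers_rightWeight]
  exact genFun_reducedTree finiteFibers_totalWeight rfl
    (finiteFibers_leftWeight.prod finiteFibers_rightWeight) rfl fun _ => rfl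

theorem genFun_totalWeight_mul : genFun (fun T : ReducedTree => totalWeight T) *
    (1 - 2 * X - X ^ 2 + X ^ 3) = 1 - X ^ 2 := by
  have hW := genFun_weight
  have hL := genFun_leftWeight
  have hR := genFun_rightWeight
  rw [genFun_totalWeight]
  set W := genFun weight
  set L := genFun leftWeight
  set R := genFun fun T : ReducedTree => rightWeight T
  have h0 : W ≠ 0 := by
    intro h
    rw [h] at hW
    simp at hW
  apply mul_left_cancel₀ h0
  -- `hL` and `hR` give `L * R * (1 - X * W) * (1 - X ^ 2 * W) = W * (1 - X ^ 2)`, and `hW` replaces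
  -- the product of the two factors by `W * (1 - 2 * X - X ^ 2 + X ^ 3)`.
  linear_combination L * R * hW + (1 - X ^ 2 * W) * R * hL + hR

/-- The set of reduced trees of weight `n`, viewed inside the set of all trees. -/
theorem image_val_totalWeight (n : ℕ) : {T : BTree | RightReduced T ∧ totalWeight T = n} =
    Subtype.val '' {T : ReducedTree | totalWeight T = n} := by
  ext T
  simp [and_comm]

theorem finite_positiveOfLength (n : ℕ) : (positiveOfLength n).Finite := by
  obtain ⟨φ, hφ⟩ := exists_bijOn_positiveOfLength
  rw [← (hφ n).image_eq, image_val_totalWeight]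
  exact ((finiteFibers_totalWeight n).image _).image _

theorem mk_p : PowerSeries.mk (fun n => (p n : ℚ)) =
    genFun fun T : ReducedTree => totalWeight T := by
  obtain ⟨φ, hφ⟩ := exists_bijOn_positiveOfLength
  ext n
  rw [coeff_mk, genFun, coeff_mk, p, ← (hφ n).image_eq, (hφ n).injOn.ncard_image,
    image_val_totalWeight, Set.ncard_image_of_injective _ Subtype.val_injective]

end ThompsonF

/-! ### Closed form and recurrence -/

open ThompsonF in
theorem mk_p_mul : PowerSeries.mk (fun n => (p n : ℚ)) *
    (1 - 2 * (X : ℚ⟦X⟧) - X ^ 2 + X ^ 3) = 1 - X ^ 2 := by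
  rw [mk_p, genFun_totalWeight_mul]

theorem theorem5p2p1 :
    (∀ n : ℕ, (ThompsonF.positiveOfLength n).Finite) ∧
    (PowerSeries.mk (fun n : ℕ => (ThompsonF.p n : ℚ)) =
      (1 - (X : ℚ⟦X⟧) ^ 2) * (1 - 2 * (X : ℚ⟦X⟧) - (X : ℚ⟦X⟧) ^ 2 + (X : ℚ⟦X⟧) ^ 3)⁻¹) ∧
    (∀ n : ℕ, 3 ≤ n →
      (ThompsonF.p n : ℤ) =
        2 * (ThompsonF.p (n - 1) : ℤ) + (ThompsonF.p (n - 2) : ℤ) - (ThompsonF.p (n - 3) : ℤ)) := by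
  refine ⟨ThompsonF.finite_positiveOfLength, ?_, fun n hn => ?_⟩
  · rw [PowerSeries.eq_mul_inv_iff_mul_eq (by simp)]
    exact mk_p_mul
  · obtain ⟨n, rfl⟩ := Nat.exists_eq_add_of_le' hn
    have h := congrArg (coeff (n + 3)) mk_p_mul
    -- The terms are put in the form of a constant times `P * X ^ k`, whose coefficients are shifted
    -- coefficients of `P`.
    rw [show ∀ P : ℚ⟦X⟧, P * (1 - 2 * X - X ^ 2 + X ^ 3) =
      P - C 2 * (P * X ^ 1) - P * X ^ 2 + P * X ^ 3 from fun P => by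
        rw [show (C 2 : ℚ⟦X⟧) = 2 from map_ofNat C 2]; ring] at h
    simp only [map_sub, map_add, coeff_C_mul, coeff_one, coeff_X_pow] at h
    rw [coeff_mul_X_pow, show n + 3 = n + 1 + 2 from rfl, coeff_mul_X_pow,
      show n + 1 + 2 = n + 2 + 1 from rfl, coeff_mul_X_pow] at h
    simp only [coeff_mk] at h
    -- The right side `1 - X ^ 2` has no coefficient in degree `n + 3`, which is why the recurrence
    -- starts at 3.
    rw [if_neg (by omega), if_neg (by omega)] at h
    have key : (ThompsonF.p (n + 3) : ℚ) = 2 * ThompsonF.p (n + 2) + ThompsonF.p (n + 1) -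
        ThompsonF.p n := by linear_combination h
    exact_mod_cast key
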